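/- **Theorem 4.1.** Let $L^1(\mathbb R^2)$ be the space of (real- or complex-valued) integrable functions on $\mathbb R^2$. An *atom* is a function $a$ for which there is a square $Q=[c_1,c_1+s]\times[c_2,c_2+s]$, $s>0$, such that $a$ vanishes outside $Q$, $|a|\le 1/|Q|$ almost everywhere, and $\int_Q a=0$. Let $H^1(\mathbb R^2)$ be the space of all $f\in L^1(\mathbb R^2)$ that can be written as $f=\sum_{j\ge1}\lambda_j a_j$, with convergence in $L^1$, where the $a_j$ are atoms and $\lambda_j$ are scalars with $\sum_j|\lambda_j|<\infty$, normed by $$\|f\|_{H^1}=\inf\Big\{\sum_j|\lambda_j| : f=\sum_j\lambda_ja_j\Big\},$$ the infimum being taken over all such decompositions. Let $H=\chi_{[0,1/2)}-\chi_{[1/2,1)}$, $$\Psi_1(x,y)=H(x)\,\chi_{[0,1]}(y),\quad \Psi_2(x,y)=\chi_{[0,1]}(x)\,H(y),\quad \Psi_3(x,y)=H(x)\,H(y),$$ and let the two-dimensional Haar system consist of the functions $$\Psi_{j,n,k,l}(x,y)=2^n\,\Psi_j(2^nx-k,\,2^ny-l),\qquad j\in\{1,2,3\},\ n,k,l\in\mathbb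 Z,$$ all of which belong to $H^1(\mathbb R^2)$. Then the closure, in the norm of $H^1(\mathbb R^2)$, of the linear span of the two-dimensional Haar system is $$H^A(\mathbb R^2)=\Big\{f\in H^1(\mathbb R^2) : \iint_{Q_i} f\,dx\,dy=0,\ i=1,2,3,4\Big\},$$ where $Q_1,Q_2,Q_3,Q_4$ are the four quadrants of $\mathbb R^2$. -/

import Mathlib

open MeasureTheory Set

noncomputable section

namespace HardyHaar

/-- The closed axis-parallel square with lower left corner `c` and side length `s`. -/
def square (c : ℝ × ℝ) (s : ℝ) : Set (ℝ × ℝ) :=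
  Icc c.1 (c.1 + s) ×ˢ Icc c.2 (c.2 + s)

/-- `a ∈ L¹(ℝ²)` is an `L^∞` atom: for some square `Q` of side length `s > 0`, `a` vanishes
outside `Q`, `|a| ≤ 1 / |Q| = 1 / s²`, and `a` has integral zero over `Q`
(all up to null sets, as `a` is a class of functions). -/
def IsAtom {𝕜 : Type*} [RCLike 𝕜] (a : Lp 𝕜 1 (volume : Measure (ℝ × ℝ))) : Prop :=
  ∃ (c : ℝ × ℝ) (s : ℝ), 0 < s ∧
    (∀ᵐ x ∂(volume : Measure (ℝ × ℝ)), x ∉ square c s → a x = 0) ∧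
    (∀ᵐ x ∂(volume : Measure (ℝ × ℝ)), ‖a x‖ ≤ 1 / s ^ 2) ∧
    ∫ x in square c s, a x = 0

/-- `f = ∑ⱼ λⱼ aⱼ` in `L¹(ℝ²)`, with atoms `aⱼ` and `∑ⱼ |λⱼ| < ∞`. -/
def IsAtomicDecomposition {𝕜 : Type*} [RCLike 𝕜] (coeff : ℕ → 𝕜)
    (a : ℕ → Lp 𝕜 1 (volume : Measure (ℝ × ℝ)))
    (f : Lp 𝕜 1 (volume : Measure (ℝ × ℝ))) : Prop :=
  (∀ j, IsAtom (a j)) ∧ Summable (fun j => ‖coeff j‖) ∧ HasSum (fun j => coeff j • a j) f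

/-- The numbers `∑ⱼ |λⱼ|` taken over all atomic decompositions of `f`. -/
def atomicSums {𝕜 : Type*} [RCLike 𝕜] (f : Lp 𝕜 1 (volume : Measure (ℝ × ℝ))) : Set ℝ :=
  {r | ∃ (coeff : ℕ → 𝕜) (a : ℕ → Lp 𝕜 1 (volume : Measure (ℝ × ℝ))),
    IsAtomicDecomposition coeff a f ∧ r = ∑' j, ‖coeff j‖}

section helpers

variable {𝕜 : Type*} [RCLike 𝕜]

lemma isAtom_zero : IsAtom (0 : Lp 𝕜 1 (volume : Measure (ℝ × ℝ))) := by
  have h := Lp.coeFn_zero 𝕜 1 (volume : Measure (ℝ × ℝ))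
  refine ⟨0, 1, one_pos, ?_, ?_, ?_⟩
  · filter_upwards [h] with x hx _ using by simp [hx]
  · filter_upwards [h] with x hx
    rw [hx]; simp
  · rw [integral_congr_ae (ae_restrict_of_ae h)]; simp

lemma volume_square (c : ℝ × ℝ) {s : ℝ} (hs : 0 < s) :
    volume (square c s) = ENNReal.ofReal (s ^ 2) := by
  rw [square, Measure.volume_eq_prod, Measure.prod_prod, Real.volume_Icc, Real.volume_Icc,
    ← ENNReal.ofReal_mul (by linarith)]
  congr 1; ring

lemma measurableSet_square (c : ℝ × ℝ) (s : ℝ) : MeasurableSet (square c s) :=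
  measurableSet_Icc.prod measurableSet_Icc

lemma IsAtom.norm_le_one {a : Lp 𝕜 1 (volume : Measure (ℝ × ℝ))} (ha : IsAtom a) :
    ‖a‖ ≤ 1 := by
  obtain ⟨c, s, hs, h0, hb, -⟩ := ha
  have hv := volume_square c hs
  have hfin : volume (square c s) < ⊤ := by rw [hv]; exact ENNReal.ofReal_lt_top
  rw [L1.norm_eq_integral_norm, ← setIntegral_eq_integral_of_ae_compl_eq_zero
    (s := square c s) (by filter_upwards [h0] with x hx hxs using by simp [hx hxs])]
  have := norm_setIntegral_le_of_norm_le_const_ae (μ := volume) (f := fun x => ‖a x‖)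
    (C := 1 / s ^ 2) hfin (ae_restrict_of_ae (by filter_upwards [hb] with x hx using by simpa using hx))
  refine (le_abs_self _).trans (this.trans ?_)
  rw [measureReal_def, hv, ENNReal.toReal_ofReal (by positivity)]
  field_simp; exact le_rfl

lemma atomicSums_nonneg {f : Lp 𝕜 1 (volume : Measure (ℝ × ℝ))} {r : ℝ}
    (hr : r ∈ atomicSums f) : 0 ≤ r := by
  obtain ⟨l, a, -, rfl⟩ := hr
  exact tsum_nonneg fun _ => norm_nonneg _

lemma norm_le_of_mem_atomicSums {f : Lp 𝕜 1 (volume : Measure (ℝ × ℝ))} {r : ℝ}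
    (hr : r ∈ atomicSums f) : ‖f‖ ≤ r := by
  obtain ⟨l, a, ⟨ha, hl, hf⟩, rfl⟩ := hr
  rw [← hf.tsum_eq]
  refine tsum_of_norm_bounded hl.hasSum fun j => ?_
  rw [norm_smul]
  exact mul_le_of_le_one_right (norm_nonneg _) (ha j).norm_le_one

lemma zero_mem_atomicSums : (0 : ℝ) ∈ atomicSums (0 : Lp 𝕜 1 (volume : Measure (ℝ × ℝ))) :=
  ⟨fun _ => 0, fun _ => 0, ⟨fun _ => isAtom_zero, by simp,
    by simp [hasSum_zero]⟩, by simp⟩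

lemma smul_mem_atomicSums {f : Lp 𝕜 1 (volume : Measure (ℝ × ℝ))} {r : ℝ} (c : 𝕜)
    (hr : r ∈ atomicSums f) : ‖c‖ * r ∈ atomicSums (c • f) := by
  obtain ⟨l, a, ⟨ha, hl, hf⟩, rfl⟩ := hr
  refine ⟨fun j => c * l j, a, ⟨ha, ?_, ?_⟩, ?_⟩
  · simpa [norm_mul] using hl.mul_left ‖c‖
  · simpa [mul_smul] using hf.const_smul c
  · simp [norm_mul, tsum_mul_left]

lemma add_mem_atomicSums {f g : Lp 𝕜 1 (volume : Measure (ℝ × ℝ))} {r t : ℝ}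
    (hr : r ∈ atomicSums f) (ht : t ∈ atomicSums g) : r + t ∈ atomicSums (f + g) := by
  obtain ⟨l, a, ⟨ha, hl, hf⟩, rfl⟩ := hr
  obtain ⟨m, b, ⟨hb, hm, hg⟩, rfl⟩ := ht
  let e : ℕ ≃ ℕ ⊕ ℕ := Equiv.natSumNatEquivNat.symm
  have hs : HasSum (fun i => ‖Sum.elim l m i‖) ((∑' j, ‖l j‖) + ∑' j, ‖m j‖) :=
    HasSum.sum (f := fun i => ‖Sum.elim l m i‖) hl.hasSum hm.hasSum
  have hv : HasSum (fun i => Sum.elim l m i • Sum.elim a b i) (f + g) :=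
    HasSum.sum (f := fun i => Sum.elim l m i • Sum.elim a b i) hf hg
  refine ⟨Sum.elim l m ∘ e, Sum.elim a b ∘ e, ⟨fun j => ?_, ?_, ?_⟩, ?_⟩
  · rcases h : e j with i | i
    · simpa [h] using ha i
    · simpa [h] using hb i
  · exact (e.summable_iff (f := fun i => ‖Sum.elim l m i‖)).2 hs.summable
  · exact (e.hasSum_iff (f := fun i => Sum.elim l m i • Sum.elim a b i)).2 hv
  · exact ((e.hasSum_iff (f := fun i => ‖Sum.elim l m i‖)).2 hs).tsum_eq.symm

end helpers

/-- The integrable functions on `ℝ²` which admit an atomic decomposition. -/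
def hardySubmodule (𝕜 : Type*) [RCLike 𝕜] :
    Submodule 𝕜 (Lp 𝕜 1 (volume : Measure (ℝ × ℝ))) where
  carrier := {f | (atomicSums f).Nonempty}
  zero_mem' := ⟨0, zero_mem_atomicSums⟩
  add_mem' := fun ⟨_, hr⟩ ⟨_, ht⟩ => ⟨_, add_mem_atomicSums hr ht⟩
  smul_mem' := fun c _ ⟨_, hr⟩ => ⟨_, smul_mem_atomicSums c hr⟩

/-- The Hardy space `H¹(ℝ²)`. It is a type of its own, so that it carries the atomic norm
(below) and not the norm of `L¹(ℝ²)`. -/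
def H1 (𝕜 : Type*) [RCLike 𝕜] : Type _ := hardySubmodule 𝕜

namespace H1

variable {𝕜 : Type*} [RCLike 𝕜]

instance : AddCommGroup (H1 𝕜) := inferInstanceAs (AddCommGroup (hardySubmodule 𝕜))

instance : Module 𝕜 (H1 𝕜) := inferInstanceAs (Module 𝕜 (hardySubmodule 𝕜))

/-- The inclusion of `H¹(ℝ²)` into `L¹(ℝ²)`. -/
def toL1 : H1 𝕜 →ₗ[𝕜] Lp 𝕜 1 (volume : Measure (ℝ × ℝ)) := (hardySubmodule 𝕜).subtype

lemma toL1_injective : Function.Injective (toL1 : H1 𝕜 → Lp 𝕜 1 (volume : Measure (ℝ × ℝ))) :=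
  Subtype.val_injective

lemma nonempty_atomicSums (f : H1 𝕜) : (atomicSums (toL1 f)).Nonempty := f.2

lemma bddBelow_atomicSums (f : H1 𝕜) : BddBelow (atomicSums (toL1 f)) :=
  ⟨0, fun _ hr => atomicSums_nonneg hr⟩

/-- The atomic norm: the infimum of `∑ⱼ |λⱼ|` over all atomic decompositions. -/
instance : Norm (H1 𝕜) := ⟨fun f => sInf (atomicSums (toL1 f))⟩

lemma norm_def (f : H1 𝕜) : ‖f‖ = sInf (atomicSums (toL1 f)) := rfl

lemma norm_le_of_mem {f : H1 𝕜} {r : ℝ} (hr : r ∈ atomicSums (toL1 f)) : ‖f‖ ≤ r :=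
  csInf_le (bddBelow_atomicSums f) hr

lemma norm_toL1_le (f : H1 𝕜) : ‖toL1 f‖ ≤ ‖f‖ :=
  le_csInf (nonempty_atomicSums f) fun _ hr => norm_le_of_mem_atomicSums hr

lemma h1_norm_nonneg (f : H1 𝕜) : 0 ≤ ‖f‖ := (norm_nonneg _).trans (norm_toL1_le f)

lemma h1_norm_add_le (f g : H1 𝕜) : ‖f + g‖ ≤ ‖f‖ + ‖g‖ := by
  refine le_of_forall_pos_le_add fun ε hε => ?_
  obtain ⟨r, hr, hr'⟩ := exists_lt_of_csInf_lt (nonempty_atomicSums f)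
    (show sInf (atomicSums (toL1 f)) < ‖f‖ + ε / 2 by rw [← norm_def]; linarith)
  obtain ⟨t, ht, ht'⟩ := exists_lt_of_csInf_lt (nonempty_atomicSums g)
    (show sInf (atomicSums (toL1 g)) < ‖g‖ + ε / 2 by rw [← norm_def]; linarith)
  have h : r + t ∈ atomicSums (toL1 (f + g)) := by
    rw [map_add]; exact add_mem_atomicSums hr ht
  linarith [norm_le_of_mem h]

lemma h1_norm_smul_le (c : 𝕜) (f : H1 𝕜) : ‖c • f‖ ≤ ‖c‖ * ‖f‖ := by
  refine le_of_forall_pos_le_add fun ε hε => ?_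
  have hc : 0 ≤ ‖c‖ := norm_nonneg c
  obtain ⟨r, hr, hr'⟩ := exists_lt_of_csInf_lt (nonempty_atomicSums f)
    (show sInf (atomicSums (toL1 f)) < ‖f‖ + ε / (‖c‖ + 1) by
      rw [← norm_def]; linarith [show 0 < ε / (‖c‖ + 1) by positivity])
  have h : ‖c‖ * r ∈ atomicSums (toL1 (c • f)) := by
    rw [map_smul]; exact smul_mem_atomicSums c hr
  have h1 : ‖c‖ * r ≤ ‖c‖ * (‖f‖ + ε / (‖c‖ + 1)) := mul_le_mul_of_nonneg_left hr'.le hc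
  have h2 : ‖c‖ * (ε / (‖c‖ + 1)) ≤ ε := by
    rw [mul_div_assoc', div_le_iff₀ (by positivity)]; nlinarith
  linarith [norm_le_of_mem h]

lemma h1_norm_zero : ‖(0 : H1 𝕜)‖ = 0 :=
  le_antisymm (norm_le_of_mem (by rw [map_zero]; exact zero_mem_atomicSums)) (h1_norm_nonneg 0)

lemma normedSpaceCore : NormedSpace.Core 𝕜 (H1 𝕜) where
  norm_nonneg := h1_norm_nonneg
  norm_triangle := h1_norm_add_le
  norm_eq_zero_iff f := by
    refine ⟨fun h => toL1_injective ?_, fun h => by rw [h, h1_norm_zero]⟩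
    rw [map_zero]
    exact norm_le_zero_iff.1 (h ▸ norm_toL1_le f)
  norm_smul c f := by
    refine le_antisymm (h1_norm_smul_le c f) ?_
    rcases eq_or_ne c 0 with rfl | hc
    · simpa using h1_norm_nonneg _
    · have h := h1_norm_smul_le c⁻¹ (c • f)
      rw [inv_smul_smul₀ hc, norm_inv] at h
      have hc' : 0 < ‖c‖ := norm_pos_iff.2 hc
      calc ‖c‖ * ‖f‖ ≤ ‖c‖ * (‖c‖⁻¹ * ‖c • f‖) := mul_le_mul_of_nonneg_left h hc'.le
        _ = ‖c • f‖ := by rw [← mul_assoc, mul_inv_cancel₀ hc'.ne', one_mul]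

instance : NormedAddCommGroup (H1 𝕜) := NormedAddCommGroup.ofCore (normedSpaceCore (𝕜 := 𝕜))

instance : NormedSpace 𝕜 (H1 𝕜) := NormedSpace.ofCore (normedSpaceCore (𝕜 := 𝕜))

end H1

/-- The Haar function `H` of the unit interval. -/
def haarH (x : ℝ) : ℝ :=
  (Ico (0 : ℝ) (1 / 2)).indicator 1 x - (Ico (1 / 2 : ℝ) 1).indicator 1 x

/-- The indicator function of `[0, 1]`. -/
def chi (x : ℝ) : ℝ := (Icc (0 : ℝ) 1).indicator 1 x

/-- The three basic functions `Ψ₁`, `Ψ₂`, `Ψ₃`. -/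
def Psi : Fin 3 → ℝ → ℝ → ℝ :=
  ![fun x y => haarH x * chi y, fun x y => chi x * haarH y, fun x y => haarH x * haarH y]

/-- `Ψ_{j,n,k,l}(x, y) = 2ⁿ Ψ_j(2ⁿ x - k, 2ⁿ y - l)`. -/
def haarFun (j : Fin 3) (n k l : ℤ) (p : ℝ × ℝ) : ℝ :=
  (2 : ℝ) ^ n * Psi j ((2 : ℝ) ^ n * p.1 - k) ((2 : ℝ) ^ n * p.2 - l)

section helpers

lemma measurable_haarH : Measurable haarH :=
  (measurable_one.indicator measurableSet_Ico).sub (measurable_one.indicator measurableSet_Ico)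

lemma measurable_chi : Measurable chi := measurable_one.indicator measurableSet_Icc

lemma abs_haarH_le (x : ℝ) : |haarH x| ≤ 1 := by
  unfold haarH indicator
  split_ifs with h1 h2 <;> simp_all

lemma abs_chi_le (x : ℝ) : |chi x| ≤ 1 := by
  unfold chi indicator
  split_ifs <;> simp

lemma haarH_eq_zero {x : ℝ} (hx : x ∉ Icc (0 : ℝ) 1) : haarH x = 0 := by
  have h1 : x ∉ Ico (0 : ℝ) (1 / 2) := fun h => hx ⟨h.1, by linarith [h.2]⟩
  have h2 : x ∉ Ico (1 / 2 : ℝ) 1 := fun h => hx ⟨by linarith [h.1], h.2.le⟩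
  simp only [haarH, indicator_of_notMem h1, indicator_of_notMem h2, sub_zero]

lemma chi_eq_zero {x : ℝ} (hx : x ∉ Icc (0 : ℝ) 1) : chi x = 0 := indicator_of_notMem hx _

lemma integral_haarH : ∫ x, haarH x = 0 := by
  unfold haarH
  rw [integral_sub]
  · rw [integral_indicator_one measurableSet_Ico, integral_indicator_one measurableSet_Ico]
    simp only [measureReal_def, Real.volume_Ico]
    norm_num
  · exact (integrable_indicator_iff measurableSet_Ico).2 (integrableOn_const (by simp))
  · exact (integrable_indicator_iff measurableSet_Ico).2 (integrableOn_const (by simp))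

lemma integral_haarH_comp (n k : ℤ) : ∫ x, haarH ((2 : ℝ) ^ n * x - k) = 0 := by
  rw [Measure.integral_comp_mul_left (fun x => haarH (x - k)) ((2 : ℝ) ^ n),
    integral_sub_right_eq_self haarH (k : ℝ), integral_haarH, smul_zero]

lemma measurable_haarFun (j : Fin 3) (n k l : ℤ) : Measurable (haarFun j n k l) := by
  have := measurable_haarH
  have := measurable_chi
  unfold haarFun Psi
  fin_cases j <;> simp <;> fun_prop

lemma abs_haarFun_le (j : Fin 3) (n k l : ℤ) (p : ℝ × ℝ) : |haarFun j n k l p| ≤ (2 : ℝ) ^ n := by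
  have h : ∀ x y, |Psi j x y| ≤ 1 := fun x y => by
    fin_cases j <;> simp only [Psi, Fin.mk_zero, Fin.mk_one, Fin.reduceFinMk, Matrix.cons_val, Matrix.cons_val_zero,
      Matrix.cons_val_one, abs_mul] <;>
    first
      | exact mul_le_one₀ (abs_haarH_le _) (abs_nonneg _) (abs_chi_le _)
      | exact mul_le_one₀ (abs_chi_le _) (abs_nonneg _) (abs_haarH_le _)
      | exact mul_le_one₀ (abs_haarH_le _) (abs_nonneg _) (abs_haarH_le _)
  rw [haarFun, abs_mul, abs_of_pos (by positivity : (0 : ℝ) < 2 ^ n)]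
  exact mul_le_of_le_one_right (by positivity) (h _ _)

lemma haarFun_eq_zero (j : Fin 3) (n k l : ℤ) {p : ℝ × ℝ}
    (hp : p ∉ square (k * (2 : ℝ) ^ (-n), l * (2 : ℝ) ^ (-n)) ((2 : ℝ) ^ (-n))) :
    haarFun j n k l p = 0 := by
  have key : ∀ (x : ℝ) (m : ℤ), (2 : ℝ) ^ n * x - m ∈ Icc (0 : ℝ) 1 →
      x ∈ Icc (m * (2 : ℝ) ^ (-n)) (m * (2 : ℝ) ^ (-n) + (2 : ℝ) ^ (-n)) := by
    intro x m h
    have h2 : (0 : ℝ) < 2 ^ n := by positivity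
    rw [zpow_neg]
    constructor
    · rw [← div_eq_mul_inv, div_le_iff₀ h2]; linarith [h.1]
    · rw [← add_one_mul, ← div_eq_mul_inv, le_div_iff₀ h2]; linarith [h.2]
  have hor : (2 : ℝ) ^ n * p.1 - k ∉ Icc (0 : ℝ) 1 ∨ (2 : ℝ) ^ n * p.2 - l ∉ Icc (0 : ℝ) 1 := by
    by_contra! h
    exact hp ⟨key _ _ h.1, key _ _ h.2⟩
  rcases hor with h | h <;> fin_cases j <;>
    simp [haarFun, Psi, haarH_eq_zero h, chi_eq_zero h]

lemma integral_haarFun (j : Fin 3) (n k l : ℤ) : ∫ p, haarFun j n k l p = 0 := by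
  unfold haarFun
  rw [integral_const_mul, Measure.volume_eq_prod]
  fin_cases j
  · exact mul_eq_zero_of_right _ ((integral_prod_mul (fun x => haarH ((2 : ℝ) ^ n * x - k))
      (fun y => chi ((2 : ℝ) ^ n * y - l))).trans (by rw [integral_haarH_comp, zero_mul]))
  · exact mul_eq_zero_of_right _ ((integral_prod_mul (fun x => chi ((2 : ℝ) ^ n * x - k))
      (fun y => haarH ((2 : ℝ) ^ n * y - l))).trans (by rw [integral_haarH_comp, mul_zero]))
  · exact mul_eq_zero_of_right _ ((integral_prod_mul (fun x => haarH ((2 : ℝ) ^ n * x - k))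
      (fun y => haarH ((2 : ℝ) ^ n * y - l))).trans (by rw [integral_haarH_comp, zero_mul]))

lemma memLp_haarFun (𝕜 : Type*) [RCLike 𝕜] (j : Fin 3) (n k l : ℤ) :
    MemLp (fun p => (haarFun j n k l p : 𝕜)) 1 (volume : Measure (ℝ × ℝ)) := by
  set Q := square (k * (2 : ℝ) ^ (-n), l * (2 : ℝ) ^ (-n)) ((2 : ℝ) ^ (-n)) with hQ
  have hQm : MeasurableSet Q := measurableSet_square _ _
  have hfin : volume Q < ⊤ := by
    rw [hQ, volume_square _ (by positivity)]; exact ENNReal.ofReal_lt_top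
  rw [memLp_one_iff_integrable]
  have hon : IntegrableOn (haarFun j n k l) Q :=
    Measure.integrableOn_of_bounded (M := (2 : ℝ) ^ n) hfin.ne
      (measurable_haarFun j n k l).aestronglyMeasurable
      (Filter.Eventually.of_forall fun p => by simpa using abs_haarFun_le j n k l p)
  exact ((integrableOn_iff_integrable_of_support_subset (fun p hp => by
    by_contra h
    exact hp (haarFun_eq_zero j n k l h))).1 hon).ofReal

/-- Each Haar function, as an element of `L¹(ℝ²)`, is in `H¹(ℝ²)`, being a multiple of an atom. -/
lemma haar_mem (𝕜 : Type*) [RCLike 𝕜] (j : Fin 3) (n k l : ℤ) :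
    (memLp_haarFun 𝕜 j n k l).toLp ∈ hardySubmodule 𝕜 := by
  set F := (memLp_haarFun 𝕜 j n k l).toLp with hF
  have h2 : (0 : ℝ) < 2 ^ n := by positivity
  have h2' : ((2 : ℝ) ^ n : ℝ) ≠ 0 := h2.ne'
  have hFe : ∀ᵐ p, F p = (haarFun j n k l p : 𝕜) := (memLp_haarFun 𝕜 j n k l).coeFn_toLp
  have hae := Lp.coeFn_smul (((2 : ℝ) ^ n : ℝ) : 𝕜) F
  have hatom : IsAtom ((((2 : ℝ) ^ n : ℝ) : 𝕜) • F) := by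
    refine ⟨(k * (2 : ℝ) ^ (-n), l * (2 : ℝ) ^ (-n)), (2 : ℝ) ^ (-n), by positivity, ?_, ?_, ?_⟩
    · filter_upwards [hFe, hae] with p h1 h3 hp
      rw [h3, Pi.smul_apply, h1, haarFun_eq_zero j n k l hp]; simp
    · filter_upwards [hFe, hae] with p h1 h3
      rw [h3, Pi.smul_apply, h1, norm_smul, RCLike.norm_ofReal, RCLike.norm_ofReal, abs_of_pos h2]
      have := abs_haarFun_le j n k l p
      calc (2 : ℝ) ^ n * |haarFun j n k l p| ≤ 2 ^ n * 2 ^ n := by gcongr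
        _ = 1 / ((2 : ℝ) ^ (-n)) ^ 2 := by rw [zpow_neg]; field_simp
    · rw [setIntegral_eq_integral_of_ae_compl_eq_zero]
      · rw [integral_congr_ae hae]
        simp only [Pi.smul_apply, integral_smul]
        rw [integral_congr_ae hFe, integral_ofReal, integral_haarFun]; simp
      · filter_upwards [hFe, hae] with p h1 h3 hp
        rw [h3, Pi.smul_apply, h1, haarFun_eq_zero j n k l hp]; simp
  have hA : (((2 : ℝ) ^ n : ℝ) : 𝕜) • F ∈ hardySubmodule 𝕜 := by
    refine ⟨1, fun i => if i = 0 then 1 else 0, fun _ => (((2 : ℝ) ^ n : ℝ) : 𝕜) • F,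
      ⟨fun _ => hatom, ?_, ?_⟩, ?_⟩
    · exact summable_of_ne_finset_zero (s := {0}) fun i hi => by simp_all
    · simpa using hasSum_single (f := fun i : ℕ =>
        (if i = 0 then (1 : 𝕜) else 0) • (((2 : ℝ) ^ n : ℝ) : 𝕜) • F) 0
        (fun i hi => by simp [hi])
    · rw [tsum_eq_single 0 (fun i hi => by simp [hi])]; simp
  have hne : (((2 : ℝ) ^ n : ℝ) : 𝕜) ≠ 0 := by exact_mod_cast h2'
  have h := (hardySubmodule 𝕜).smul_mem ((((2 : ℝ) ^ n : ℝ) : 𝕜)⁻¹) hA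
  rwa [inv_smul_smul₀ hne] at h

end helpers

/-- The Haar function `Ψ_{j,n,k,l}` as an element of `H¹(ℝ²)`. -/
def haar (𝕜 : Type*) [RCLike 𝕜] (j : Fin 3) (n k l : ℤ) : H1 𝕜 :=
  ⟨(memLp_haarFun 𝕜 j n k l).toLp, haar_mem 𝕜 j n k l⟩

/-- The two-dimensional Haar system in `H¹(ℝ²)`. -/
def haarSystem (𝕜 : Type*) [RCLike 𝕜] : Set (H1 𝕜) :=
  {f | ∃ (j : Fin 3) (n k l : ℤ), f = haar 𝕜 j n k l}

/-- The four (open) quadrants of the plane. -/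
def quadrant : Fin 4 → Set (ℝ × ℝ) :=
  ![Ioi 0 ×ˢ Ioi 0, Iio 0 ×ˢ Ioi 0, Iio 0 ×ˢ Iio 0, Ioi 0 ×ˢ Iio 0]

/-- `H^A(ℝ²)`: the functions in `H¹(ℝ²)` with integral zero over each quadrant. -/
def HA (𝕜 : Type*) [RCLike 𝕜] : Submodule 𝕜 (H1 𝕜) where
  carrier := {f | ∀ i, ∫ p in quadrant i, H1.toL1 f p = 0}
  zero_mem' i := by
    rw [map_zero, integral_congr_ae (ae_restrict_of_ae (Lp.coeFn_zero 𝕜 1 volume))]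
    simp
  add_mem' {f g} hf hg i := by
    rw [map_add, integral_congr_ae (ae_restrict_of_ae (Lp.coeFn_add _ _))]
    simp only [Pi.add_apply]
    rw [integral_add (L1.integrable_coeFn _).integrableOn (L1.integrable_coeFn _).integrableOn,
      hf i, hg i, add_zero]
  smul_mem' c f hf i := by
    rw [map_smul, integral_congr_ae (ae_restrict_of_ae (Lp.coeFn_smul _ _))]
    simp only [Pi.smul_apply]
    rw [integral_smul, hf i, smul_zero]

end HardyHaar

end

/-!
Membership in `H^A(ℝ²)` is a closed condition satisfied by the Haar functions. For the converse, an
`H^A` function is first approximated by boundedly supported bounded ones: these are dense in `H¹`,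
and the joint kernel of finitely many continuous functionals meets a dense subspace densely. Up to
null sets, such a function splits along the quadrants into four mean-zero pieces, each living on a
single dyadic square.

The dyadic averages of such a piece are finite Haar sums which converge to it in `L¹`. Convergence
in `H¹` follows because, for mean-zero functions on a fixed square with a common bound, smallness in
`L¹` forces smallness in `H¹`: stopping at height `l`, the Calderón–Zygmund decomposition gives a
good part bounded by `4 l`, and a bad part made of mean-zero functions on the stopping squares,
whose total area is at most `‖f‖₁ / l`.
-/

noncomputable section

namespace HardyHaar

open Filter Topology Function

/-- The index of the dyadic square of side `2⁻ⁿ` containing `p`. -/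
def dyadicIdx (n : ℤ) (p : ℝ × ℝ) : ℤ × ℤ := (⌊(2 : ℝ) ^ n * p.1⌋, ⌊(2 : ℝ) ^ n * p.2⌋)

/-- The half-open dyadic square of side `2⁻ⁿ` with index `κ`. -/
def dyadicSquare (n : ℤ) (κ : ℤ × ℤ) : Set (ℝ × ℝ) := dyadicIdx n ⁻¹' {κ}

lemma mem_dyadicSquare {n : ℤ} {κ : ℤ × ℤ} {p : ℝ × ℝ} :
    p ∈ dyadicSquare n κ ↔ dyadicIdx n p = κ := Iff.rfl

lemma mem_dyadicSquare_dyadicIdx (n : ℤ) (p : ℝ × ℝ) : p ∈ dyadicSquare n (dyadicIdx n p) := rfl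

/-- The lower left corner of the dyadic square of side `2⁻ⁿ` with index `κ`. -/
def corner (n : ℤ) (κ : ℤ × ℤ) : ℝ × ℝ := (κ.1 * (2 : ℝ) ^ (-n), κ.2 * (2 : ℝ) ^ (-n))

lemma floor_two_zpow_mul_eq_iff {n m : ℤ} {x : ℝ} :
    ⌊(2 : ℝ) ^ n * x⌋ = m ↔
      x ∈ Ico (m * (2 : ℝ) ^ (-n)) (m * (2 : ℝ) ^ (-n) + (2 : ℝ) ^ (-n)) := by
  have h2 : (0 : ℝ) < 2 ^ n := by positivity
  rw [Int.floor_eq_iff, zpow_neg, mem_Ico, ← add_one_mul, ← div_eq_mul_inv, ← div_eq_mul_inv,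
    div_le_iff₀ h2, lt_div_iff₀ h2, mul_comm x]

lemma dyadicSquare_eq_prod (n : ℤ) (κ : ℤ × ℤ) :
    dyadicSquare n κ = Ico (corner n κ).1 ((corner n κ).1 + (2 : ℝ) ^ (-n)) ×ˢ
      Ico (corner n κ).2 ((corner n κ).2 + (2 : ℝ) ^ (-n)) := by
  ext p
  simp only [mem_dyadicSquare, dyadicIdx, Prod.ext_iff, floor_two_zpow_mul_eq_iff, mem_prod, corner]

lemma dyadicSquare_subset_square (n : ℤ) (κ : ℤ × ℤ) :
    dyadicSquare n κ ⊆ square (corner n κ) ((2 : ℝ) ^ (-n)) := by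
  rw [dyadicSquare_eq_prod]
  exact prod_mono Ico_subset_Icc_self Ico_subset_Icc_self

lemma dyadicSquare_ae_eq_square (n : ℤ) (κ : ℤ × ℤ) :
    dyadicSquare n κ =ᵐ[volume] square (corner n κ) ((2 : ℝ) ^ (-n)) := by
  rw [dyadicSquare_eq_prod, square, Measure.volume_eq_prod]
  exact Measure.set_prod_ae_eq Ico_ae_eq_Icc Ico_ae_eq_Icc

@[fun_prop]
lemma measurable_dyadicIdx (n : ℤ) : Measurable (dyadicIdx n) := by
  unfold dyadicIdx
  fun_prop

lemma measurableSet_dyadicSquare (n : ℤ) (κ : ℤ × ℤ) : MeasurableSet (dyadicSquare n κ) :=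
  measurable_dyadicIdx n (measurableSet_singleton κ)

lemma volume_dyadicSquare (n : ℤ) (κ : ℤ × ℤ) :
    volume (dyadicSquare n κ) = ENNReal.ofReal (((2 : ℝ) ^ (-n)) ^ 2) := by
  rw [measure_congr (dyadicSquare_ae_eq_square n κ), volume_square _ (by positivity)]

lemma volume_real_dyadicSquare (n : ℤ) (κ : ℤ × ℤ) :
    volume.real (dyadicSquare n κ) = ((2 : ℝ) ^ (-n)) ^ 2 := by
  rw [measureReal_def, volume_dyadicSquare, ENNReal.toReal_ofReal (by positivity)]

lemma volume_dyadicSquare_lt_top (n : ℤ) (κ : ℤ × ℤ) : volume (dyadicSquare n κ) < ⊤ := by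
  rw [volume_dyadicSquare]; exact ENNReal.ofReal_lt_top

lemma pairwise_disjoint_dyadicSquare (n : ℤ) : Pairwise (Disjoint on dyadicSquare n) :=
  pairwise_disjoint_fiber (dyadicIdx n)

/-- The index of the dyadic square `i` generations above the one with index `κ`. -/
def ancestor (i : ℕ) (κ : ℤ × ℤ) : ℤ × ℤ := (κ.1 / 2 ^ i, κ.2 / 2 ^ i)

lemma ancestor_zero (κ : ℤ × ℤ) : ancestor 0 κ = κ := by simp [ancestor]

lemma ancestor_ancestor (i j : ℕ) (κ : ℤ × ℤ) :
    ancestor i (ancestor j κ) = ancestor (i + j) κ := by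
  simp only [ancestor, Int.ediv_ediv_of_nonneg (pow_nonneg zero_le_two _), ← pow_add, add_comm i]

lemma ancestor_dyadicIdx (n : ℤ) (i : ℕ) (p : ℝ × ℝ) :
    ancestor i (dyadicIdx (n + i) p) = dyadicIdx n p := by
  have key (x : ℝ) : ⌊(2 : ℝ) ^ (n + i) * x⌋ / 2 ^ i = ⌊(2 : ℝ) ^ n * x⌋ := by
    rw [← Int.mul_cast_floor_div_cancel_of_pos (n := 2 ^ i) (by positivity) ((2 : ℝ) ^ n * x),
      zpow_add₀ two_ne_zero, zpow_natCast]
    congr 2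
    push_cast
    ring
  simp only [ancestor, dyadicIdx, key]

lemma dyadicSquare_subset_ancestor (n : ℤ) (i : ℕ) (κ : ℤ × ℤ) :
    dyadicSquare (n + i) κ ⊆ dyadicSquare n (ancestor i κ) := by
  rintro p rfl
  exact (ancestor_dyadicIdx n i p).symm

lemma dyadicSquare_dyadicIdx_anti {m n : ℤ} (h : n ≤ m) (p : ℝ × ℝ) :
    dyadicSquare m (dyadicIdx m p) ⊆ dyadicSquare n (dyadicIdx n p) := by
  obtain ⟨i, rfl⟩ := Int.le.dest h
  rw [← ancestor_dyadicIdx n i p]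
  exact dyadicSquare_subset_ancestor n i _

/-- The indices of the `4 ^ i` dyadic squares `i` generations below the one with index `κ`. -/
def descendants (i : ℕ) (κ : ℤ × ℤ) : Finset (ℤ × ℤ) :=
  Finset.Ico (κ.1 * 2 ^ i) (κ.1 * 2 ^ i + 2 ^ i) ×ˢ Finset.Ico (κ.2 * 2 ^ i) (κ.2 * 2 ^ i + 2 ^ i)

lemma mem_descendants {i : ℕ} {κ κ' : ℤ × ℤ} : κ' ∈ descendants i κ ↔ ancestor i κ' = κ := by
  simp only [descendants, ancestor, Finset.mem_product, Finset.mem_Ico, Prod.ext_iff,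
    Int.ediv_eq_iff_of_pos (show (0 : ℤ) < 2 ^ i by positivity)]

lemma biUnion_descendants (n : ℤ) (i : ℕ) (κ : ℤ × ℤ) :
    ⋃ κ' ∈ descendants i κ, dyadicSquare (n + i) κ' = dyadicSquare n κ := by
  ext p
  simp only [mem_iUnion, mem_dyadicSquare, exists_prop, exists_eq_right', mem_descendants,
    ancestor_dyadicIdx]

section BoundedOn

variable {α E : Type*} [MeasureSpace α] [NormedAddCommGroup E] {f g : α → E} {Q R : Set α}
  {M N : ℝ}

/-- `f` is, up to null sets, bounded by `M` and supported in `Q`: a bounded function as in the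
definition of an atom, without its normalization and cancellation. -/
structure BoundedOn (f : α → E) (Q : Set α) (M : ℝ) : Prop where
  ae_norm_le : ∀ᵐ x, ‖f x‖ ≤ M
  ae_eq_zero : ∀ᵐ x, x ∉ Q → f x = 0

namespace BoundedOn

lemma nonneg [NeZero (volume : Measure α)] (h : BoundedOn f Q M) : 0 ≤ M :=
  let ⟨x, hx⟩ := h.ae_norm_le.exists
  (norm_nonneg (f x)).trans hx

lemma mono (h : BoundedOn f Q M) (hQ : Q ⊆ R) : BoundedOn f R M where
  ae_norm_le := h.ae_norm_le
  ae_eq_zero := h.ae_eq_zero.mono fun _ hx hxR => hx (notMem_subset hQ hxR)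

lemma congr (h : BoundedOn f Q M) (hfg : f =ᵐ[volume] g) : BoundedOn g Q M where
  ae_norm_le := by filter_upwards [h.ae_norm_le, hfg] with x hx hx' using hx' ▸ hx
  ae_eq_zero := by filter_upwards [h.ae_eq_zero, hfg] with x hx hx' using hx' ▸ hx

lemma add (hf : BoundedOn f Q M) (hg : BoundedOn g R N) : BoundedOn (f + g) (Q ∪ R) (M + N) where
  ae_norm_le := by
    filter_upwards [hf.ae_norm_le, hg.ae_norm_le] with x hx hx' using norm_add_le_of_le hx hx'
  ae_eq_zero := by
    filter_upwards [hf.ae_eq_zero, hg.ae_eq_zero] with x hx hx' hxQR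
    rw [mem_union, not_or] at hxQR
    simp only [Pi.add_apply, hx hxQR.1, hx' hxQR.2, add_zero]

lemma sub (hf : BoundedOn f Q M) (hg : BoundedOn g Q N) : BoundedOn (f - g) Q (M + N) where
  ae_norm_le := by
    filter_upwards [hf.ae_norm_le, hg.ae_norm_le] with x hx hx' using norm_sub_le_of_le hx hx'
  ae_eq_zero := by
    filter_upwards [hf.ae_eq_zero, hg.ae_eq_zero] with x hx hx' hxQ
    simp only [Pi.sub_apply, hx hxQ, hx' hxQ, sub_zero]

lemma smul {𝕜 : Type*} [NormedField 𝕜] [NormedSpace 𝕜 E] (c : 𝕜) (hf : BoundedOn f Q M) :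
    BoundedOn (c • f) Q (‖c‖ * M) where
  ae_norm_le := by
    filter_upwards [hf.ae_norm_le] with x hx
    rw [Pi.smul_apply, norm_smul]
    gcongr
  ae_eq_zero := hf.ae_eq_zero.mono fun x hx hxQ => by rw [Pi.smul_apply, hx hxQ, smul_zero]

lemma indicator (hf : BoundedOn f Q M) : BoundedOn (R.indicator f) (R ∩ Q) M where
  ae_norm_le := hf.ae_norm_le.mono fun _ hx => (norm_indicator_le_norm_self f _).trans hx
  ae_eq_zero := hf.ae_eq_zero.mono fun _ hx hxRQ =>
    indicator_apply_eq_zero.2 fun hxR => hx fun hxQ => hxRQ ⟨hxR, hxQ⟩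

lemma ae_norm_le_indicator (hf : BoundedOn f Q M) : ∀ᵐ x, ‖f x‖ ≤ Q.indicator (fun _ => M) x := by
  filter_upwards [hf.ae_norm_le, hf.ae_eq_zero] with x hx hx'
  by_cases hxQ : x ∈ Q
  · rwa [indicator_of_mem hxQ]
  · rw [indicator_of_notMem hxQ, hx' hxQ, norm_zero]

end BoundedOn

end BoundedOn

section dyadicMean

variable {E : Type*} [NormedAddCommGroup E] [NormedSpace ℝ E] {n : ℤ} {κ : ℤ × ℤ}
  {f : ℝ × ℝ → E} {M : ℝ}

/-- The average of `f` over the dyadic square of side `2⁻ⁿ` containing `p`. -/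
def dyadicMean (n : ℤ) (f : ℝ × ℝ → E) (p : ℝ × ℝ) : E :=
  ⨍ x in dyadicSquare n (dyadicIdx n p), f x

lemma setIntegral_dyadicSquare (n : ℤ) (κ : ℤ × ℤ) (f : ℝ × ℝ → E) :
    ∫ x in dyadicSquare n κ, f x = (((2 : ℝ) ^ (-n)) ^ 2) • ⨍ x in dyadicSquare n κ, f x := by
  rw [setAverage_eq, volume_real_dyadicSquare, smul_inv_smul₀ (by positivity)]

lemma norm_setAverage_dyadicSquare_le (hf : ∀ᵐ x, ‖f x‖ ≤ M) :
    ‖⨍ x in dyadicSquare n κ, f x‖ ≤ M := by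
  have h := norm_setIntegral_le_of_norm_le_const_ae (volume_dyadicSquare_lt_top n κ)
    (ae_restrict_of_ae hf)
  rw [volume_real_dyadicSquare, setIntegral_dyadicSquare, norm_smul,
    Real.norm_of_nonneg (by positivity), mul_comm] at h
  exact le_of_mul_le_mul_right h (by positivity)

lemma setAverage_dyadicSquare_eq_zero (h : ∀ᵐ x, x ∈ dyadicSquare n κ → f x = 0) :
    ⨍ x in dyadicSquare n κ, f x = 0 := by
  rw [setAverage_congr_fun (measurableSet_dyadicSquare n κ) h]
  simp only [average_zero]

lemma stronglyMeasurable_dyadicMean (n : ℤ) (f : ℝ × ℝ → E) :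
    StronglyMeasurable (dyadicMean n f) :=
  (StronglyMeasurable.of_discrete (f := fun κ => ⨍ x in dyadicSquare n κ, f x)).comp_measurable
    (measurable_dyadicIdx n)

lemma dyadicMean_eq_zero_of_notMem (hf : ∀ᵐ x, x ∉ dyadicSquare n κ → f x = 0) {m : ℤ}
    (hm : n ≤ m) {p : ℝ × ℝ} (hp : p ∉ dyadicSquare n κ) : dyadicMean m f p = 0 := by
  refine setAverage_dyadicSquare_eq_zero (hf.mono fun x hx hxp => hx ?_)
  rw [mem_dyadicSquare, mem_dyadicSquare.1 (dyadicSquare_dyadicIdx_anti hm p hxp)]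
  exact hp

lemma BoundedOn.dyadicMean (hf : BoundedOn f (dyadicSquare n κ) M) {m : ℤ} (hm : n ≤ m) :
    BoundedOn (dyadicMean m f) (dyadicSquare n κ) M where
  ae_norm_le := .of_forall fun _ => norm_setAverage_dyadicSquare_le hf.ae_norm_le
  ae_eq_zero := .of_forall fun _ => dyadicMean_eq_zero_of_notMem hf.ae_eq_zero hm

lemma ae_tendsto_dyadicMean [CompleteSpace E] (n : ℤ) (hf : LocallyIntegrable f) :
    ∀ᵐ p, Tendsto (fun i : ℕ => dyadicMean (n + i) f p) atTop (𝓝 (f p)) := by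
  filter_upwards [IsUnifLocDoublingMeasure.ae_tendsto_average volume hf 1] with p hp
  set r : ℕ → ℝ := fun i => (2 : ℝ) ^ (-(n + i)) / 2 with hr
  set w : ℕ → ℝ × ℝ := fun i => corner (n + i) (dyadicIdx (n + i) p) + (r i, r i)
  -- A square is a closed ball of the sup metric of the product.
  have hball (i : ℕ) : Metric.closedBall (w i) (r i) =
      square (corner (n + i) (dyadicIdx (n + i) p)) ((2 : ℝ) ^ (-(n + i))) := by
    rw [← closedBall_prod_same, Real.closedBall_eq_Icc, Real.closedBall_eq_Icc, square]
    simp only [hr, Prod.fst_add, Prod.snd_add]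
    congr 2 <;> ring
  have hlim : Tendsto r atTop (𝓝[>] 0) := by
    refine tendsto_nhdsWithin_iff.2 ⟨?_, .of_forall fun i => mem_Ioi.2 (by positivity)⟩
    have h := (tendsto_pow_atTop_nhds_zero_of_lt_one (r := (2⁻¹ : ℝ)) (by norm_num)
      (by norm_num)).const_mul ((2 : ℝ) ^ (-n) / 2)
    rw [mul_zero] at h
    refine h.congr fun i => ?_
    simp only [hr]
    rw [neg_add, zpow_add₀ two_ne_zero, zpow_neg _ (i : ℤ), zpow_natCast, inv_pow]
    ring
  have h := hp w r hlim (.of_forall fun i => by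
    rw [one_mul, hball]; exact dyadicSquare_subset_square _ _ (mem_dyadicSquare_dyadicIdx _ _))
  refine h.congr fun i => ?_
  rw [hball, dyadicMean]
  exact setAverage_congr (dyadicSquare_ae_eq_square _ _).symm

lemma tendsto_integral_norm_sub_dyadicMean [CompleteSpace E] (hint : Integrable f)
    (hf : BoundedOn f (dyadicSquare n κ) M) :
    Tendsto (fun i : ℕ => ∫ p, ‖(f - dyadicMean (n + i) f) p‖) atTop (𝓝 0) := by
  have hbound (i : ℕ) : ∀ᵐ p, ‖‖(f - dyadicMean (n + i) f) p‖‖ ≤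
      (dyadicSquare n κ).indicator (fun _ => M + M) p := by
    simpa only [norm_norm] using (hf.sub (hf.dyadicMean (by lia))).ae_norm_le_indicator
  rw [← integral_zero (ℝ × ℝ) ℝ]
  refine tendsto_integral_of_dominated_convergence _ (fun i => ?_) ?_ hbound ?_
  · exact (hint.1.sub (stronglyMeasurable_dyadicMean _ f).aestronglyMeasurable).norm
  · exact (integrable_indicator_iff (measurableSet_dyadicSquare n κ)).2
      (integrableOn_const (volume_dyadicSquare_lt_top n κ).ne)
  · filter_upwards [ae_tendsto_dyadicMean n hint.locallyIntegrable] with p hp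
    simpa only [Pi.sub_apply, sub_self, norm_zero] using (hp.const_sub (f p)).norm

end dyadicMean

lemma dyadicMean_succ_le {f : ℝ × ℝ → ℝ} (hf : Integrable f) (h0 : 0 ≤ f) (n : ℤ) (p : ℝ × ℝ) :
    dyadicMean (n + 1) f p ≤ 4 * dyadicMean n f p := by
  have h := setIntegral_mono_set hf.integrableOn (.of_forall h0)
    (dyadicSquare_dyadicIdx_anti (by lia : n ≤ n + 1) p).eventuallyLE
  rw [setIntegral_dyadicSquare, setIntegral_dyadicSquare, smul_eq_mul, smul_eq_mul] at h
  have hvol : ((2 : ℝ) ^ (-n)) ^ 2 = ((2 : ℝ) ^ (-(n + 1))) ^ 2 * 4 := by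
    rw [neg_add, zpow_add₀ two_ne_zero]
    ring
  rw [hvol, mul_assoc] at h
  exact le_of_mul_le_mul_left h (by positivity)

/-- Integration over `A` as a continuous functional on `L¹(μ)`. -/
def setIntegralCLM (𝕜 : Type*) [RCLike 𝕜] {X : Type*} [MeasurableSpace X] (μ : Measure X)
    (A : Set X) : Lp 𝕜 1 μ →L[𝕜] 𝕜 where
  toFun f := ∫ x in A, f x ∂μ
  map_add' f g := by
    rw [integral_congr_ae (ae_restrict_of_ae (Lp.coeFn_add f g))]
    exact integral_add (L1.integrable_coeFn f).integrableOn (L1.integrable_coeFn g).integrableOn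
  map_smul' c f := by
    rw [integral_congr_ae (ae_restrict_of_ae (Lp.coeFn_smul c f))]
    exact integral_smul c _
  cont := continuous_setIntegral A

variable {𝕜 : Type*} [RCLike 𝕜]

lemma setIntegralCLM_apply {X : Type*} [MeasurableSpace X] (μ : Measure X) (A : Set X)
    (f : Lp 𝕜 1 μ) : setIntegralCLM 𝕜 μ A f = ∫ x in A, f x ∂μ := rfl

section atomicSums

variable {ι : Type*} [Countable ι] {f : Lp 𝕜 1 (volume : Measure (ℝ × ℝ))}

lemma tsum_mem_atomicSums {coeff : ι → 𝕜} {a : ι → Lp 𝕜 1 (volume : Measure (ℝ × ℝ))}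
    (ha : ∀ i, IsAtom (a i)) (hc : Summable fun i => ‖coeff i‖)
    (hf : HasSum (fun i => coeff i • a i) f) : ∑' i, ‖coeff i‖ ∈ atomicSums f := by
  -- Padding the index type with zero atoms makes it infinite, hence equivalent to `ℕ`.
  obtain ⟨e⟩ : Nonempty (ℕ ≃ ι ⊕ ℕ) := nonempty_equiv_of_countable
  let coeff' : ι ⊕ ℕ → 𝕜 := Sum.elim coeff 0
  let a' : ι ⊕ ℕ → Lp 𝕜 1 (volume : Measure (ℝ × ℝ)) := Sum.elim a 0
  have hnorm : HasSum (fun i => ‖coeff' i‖) (∑' i, ‖coeff i‖) :=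
    (Sum.inl_injective.hasSum_iff (by simp [coeff'])).1 hc.hasSum
  have hsum : HasSum (fun i => coeff' i • a' i) f :=
    (Sum.inl_injective.hasSum_iff (by simp [coeff'])).1 hf
  have ha' : ∀ i, IsAtom (a' i) := Sum.forall.2 ⟨ha, fun _ => isAtom_zero⟩
  have hnorm_e := (e.hasSum_iff (f := fun i => ‖coeff' i‖)).2 hnorm
  have hsum_e := (e.hasSum_iff (f := fun i => coeff' i • a' i)).2 hsum
  exact ⟨coeff' ∘ e, a' ∘ e, ⟨fun j => ha' (e j), hnorm_e.summable, hsum_e⟩, hnorm_e.tsum_eq.symm⟩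

lemma exists_isAtom_smul_eq {c : ℝ × ℝ} {s M : ℝ} (hs : 0 < s) (hf : BoundedOn f (square c s) M)
    (hint : ∫ x, f x = 0) :
    ∃ a : Lp 𝕜 1 (volume : Measure (ℝ × ℝ)), IsAtom a ∧ ((M * s ^ 2 : ℝ) : 𝕜) • a = f := by
  rcases hf.nonneg.eq_or_lt with rfl | hM
  · refine ⟨0, isAtom_zero, ?_⟩
    rw [smul_zero, eq_comm, Lp.eq_zero_iff_ae_eq_zero]
    filter_upwards [hf.ae_norm_le] with x hx using norm_le_zero_iff.1 hx
  · have hne : ((M * s ^ 2 : ℝ) : 𝕜) ≠ 0 := RCLike.ofReal_ne_zero.2 (by positivity)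
    have hae := Lp.coeFn_smul (((M * s ^ 2 : ℝ) : 𝕜)⁻¹) f
    have hb := (hf.smul (((M * s ^ 2 : ℝ) : 𝕜)⁻¹)).congr hae.symm
    refine ⟨((M * s ^ 2 : ℝ) : 𝕜)⁻¹ • f, ⟨c, s, hs, hb.ae_eq_zero, ?_, ?_⟩, smul_inv_smul₀ hne f⟩
    · convert hb.ae_norm_le using 3
      rw [norm_inv, RCLike.norm_ofReal, abs_of_pos (by positivity)]
      field_simp
    · rw [setIntegral_eq_integral_of_ae_compl_eq_zero hb.ae_eq_zero, integral_congr_ae hae]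
      simp only [Pi.smul_apply]
      rw [integral_smul, hint, smul_zero]

lemma tsum_mem_atomicSums_of_boundedOn {u : ι → Lp 𝕜 1 (volume : Measure (ℝ × ℝ))}
    {c : ι → ℝ × ℝ} {s M : ι → ℝ} (hs : ∀ i, 0 < s i)
    (hu : ∀ i, BoundedOn (u i) (square (c i) (s i)) (M i)) (hint : ∀ i, ∫ x, u i x = 0)
    (hM : Summable fun i => M i * s i ^ 2) (hf : HasSum u f) :
    ∑' i, M i * s i ^ 2 ∈ atomicSums f := by
  choose a ha hau using fun i => exists_isAtom_smul_eq (hs i) (hu i) (hint i)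
  have hnorm (i : ι) : ‖((M i * s i ^ 2 : ℝ) : 𝕜)‖ = M i * s i ^ 2 :=
    RCLike.norm_of_nonneg (mul_nonneg (hu i).nonneg (sq_nonneg _))
  rw [← tsum_congr hnorm]
  exact tsum_mem_atomicSums ha (by simpa only [hnorm]) (by simpa only [hau])

lemma mem_atomicSums_of_boundedOn {c : ℝ × ℝ} {s M : ℝ} (hs : 0 < s)
    (hf : BoundedOn f (square c s) M) (hint : ∫ x, f x = 0) : M * s ^ 2 ∈ atomicSums f := by
  simpa using tsum_mem_atomicSums_of_boundedOn (ι := Unit) (fun _ => hs) (fun _ => hf)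
    (fun _ => hint) .of_finite (hasSum_unique _)

end atomicSums

lemma IsAtom.integral_eq_zero {a : Lp 𝕜 1 (volume : Measure (ℝ × ℝ))} (ha : IsAtom a) :
    ∫ x, a x = 0 := by
  obtain ⟨c, s, -, h0, -, hint⟩ := ha
  rw [← setIntegral_eq_integral_of_ae_compl_eq_zero h0, hint]

namespace H1

lemma integral_toL1 (F : H1 𝕜) : ∫ x, toL1 F x = 0 := by
  obtain ⟨-, coeff, a, ⟨ha, -, hF⟩, -⟩ := nonempty_atomicSums F
  have h := hF.mapL (setIntegralCLM 𝕜 volume univ)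
  simp only [map_smul, setIntegralCLM_apply, setIntegral_univ, (ha _).integral_eq_zero,
    smul_zero] at h
  exact h.unique hasSum_zero

lemma exists_toL1_eq {f : Lp 𝕜 1 (volume : Measure (ℝ × ℝ))} {c : ℝ × ℝ} {s M : ℝ} (hs : 0 < s)
    (hf : BoundedOn f (square c s) M) (hint : ∫ x, f x = 0) : ∃ F : H1 𝕜, toL1 F = f :=
  ⟨⟨f, _, mem_atomicSums_of_boundedOn hs hf hint⟩, rfl⟩

end H1

section stopping

variable {n : ℤ} {v : ℝ × ℝ → ℝ} {l : ℝ}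

/-- The average of `v` over the dyadic square of side `2⁻⁽ⁿ⁺ⁱ⁾` containing `p` exceeds `l`, while
those over the larger ones, starting from generation `n`, do not. -/
def StopsAt (n : ℤ) (v : ℝ × ℝ → ℝ) (l : ℝ) (i : ℕ) (p : ℝ × ℝ) : Prop :=
  l < dyadicMean (n + i) v p ∧ ∀ j < i, dyadicMean (n + j) v p ≤ l

/-- The pairs `(i, κ)` indexing the maximal dyadic squares, of side `2⁻⁽ⁿ⁺ⁱ⁾ ≤ 2⁻ⁿ`, on which the
average of `v` exceeds `l`. -/
def stoppingIndices (n : ℤ) (v : ℝ × ℝ → ℝ) (l : ℝ) : Set (ℕ × ℤ × ℤ) :=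
  {x | ∃ p ∈ dyadicSquare (n + x.1) x.2, StopsAt n v l x.1 p}

/-- The maximal dyadic squares, of side at most `2⁻ⁿ`, on which the average of `v` exceeds `l`. -/
def stoppingSquare (n : ℤ) (v : ℝ × ℝ → ℝ) (l : ℝ) (x : stoppingIndices n v l) : Set (ℝ × ℝ) :=
  dyadicSquare (n + x.1.1) x.1.2

lemma StopsAt.congr {i : ℕ} {p q : ℝ × ℝ} (h : StopsAt n v l i p)
    (hpq : dyadicIdx (n + i) p = dyadicIdx (n + i) q) : StopsAt n v l i q := by
  have hmean (j : ℕ) (hj : j ≤ i) : dyadicMean (n + j) v p = dyadicMean (n + j) v q := by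
    have hq : q ∈ dyadicSquare (n + j) (dyadicIdx (n + j) p) :=
      dyadicSquare_dyadicIdx_anti (by lia) p hpq.symm
    rw [dyadicMean, dyadicMean, mem_dyadicSquare.1 hq]
  exact ⟨hmean i le_rfl ▸ h.1, fun j hj => hmean j hj.le ▸ h.2 j hj⟩

lemma stopsAt_of_mem_stoppingSquare {x : stoppingIndices n v l} {p : ℝ × ℝ}
    (hp : p ∈ stoppingSquare n v l x) : StopsAt n v l x.1.1 p := by
  obtain ⟨q, hq, h⟩ := x.2
  exact h.congr (hq.trans hp.symm)

lemma StopsAt.index_unique {i j : ℕ} {p : ℝ × ℝ} (hi : StopsAt n v l i p)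
    (hj : StopsAt n v l j p) : i = j := by
  by_contra hne
  rcases lt_or_gt_of_ne hne with h | h
  · exact (hj.2 i h).not_gt hi.1
  · exact (hi.2 j h).not_gt hj.1

lemma pairwise_disjoint_stoppingSquare : Pairwise (Disjoint on stoppingSquare n v l) := by
  refine fun x y hxy => Set.disjoint_left.2 fun p hx hy => hxy (Subtype.ext ?_)
  have hgen : x.1.1 = y.1.1 :=
    (stopsAt_of_mem_stoppingSquare hx).index_unique (stopsAt_of_mem_stoppingSquare hy)
  refine Prod.ext hgen ?_
  rw [← mem_dyadicSquare.1 hx, ← mem_dyadicSquare.1 hy, hgen]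

lemma dyadicMean_le_of_notMem_stoppingSquare {p : ℝ × ℝ}
    (hp : ∀ x, p ∉ stoppingSquare n v l x) (i : ℕ) : dyadicMean (n + i) v p ≤ l := by
  classical
  by_contra! hi
  have hex : ∃ i : ℕ, l < dyadicMean (n + i) v p := ⟨i, hi⟩
  have hstops : StopsAt n v l (Nat.find hex) p :=
    ⟨Nat.find_spec hex, fun j hj => not_lt.1 (Nat.find_min hex hj)⟩
  exact hp ⟨(Nat.find hex, dyadicIdx (n + Nat.find hex) p), p, rfl, hstops⟩ rfl

lemma lt_setAverage_stoppingSquare (x : stoppingIndices n v l) :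
    l < ⨍ p in stoppingSquare n v l x, v p := by
  obtain ⟨p, hp, hstops⟩ := x.2
  rw [stoppingSquare, ← mem_dyadicSquare.1 hp]
  exact hstops.1

lemma setAverage_stoppingSquare_le (hv : Integrable v) (hv0 : 0 ≤ v)
    (hl : ∀ p, dyadicMean n v p ≤ l) (x : stoppingIndices n v l) :
    ⨍ p in stoppingSquare n v l x, v p ≤ 4 * l := by
  obtain ⟨⟨_ | i, κ⟩, p, hp, hstops⟩ := x
  · exact absurd hstops.1 (by simpa using hl p)
  calc ⨍ p in dyadicSquare (n + (i + 1 : ℕ)) κ, v p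
    _ = dyadicMean (n + i + 1) v p := by
      rw [dyadicMean, add_assoc, ← Nat.cast_succ, mem_dyadicSquare.1 hp]
    _ ≤ 4 * dyadicMean (n + i) v p := dyadicMean_succ_le hv hv0 _ p
    _ ≤ 4 * l := by gcongr; exact hstops.2 i i.lt_succ_self

lemma stoppingSquare_subset {κ : ℤ × ℤ} (hv : ∀ᵐ p, p ∉ dyadicSquare n κ → v p = 0) (hl : 0 < l)
    (x : stoppingIndices n v l) : stoppingSquare n v l x ⊆ dyadicSquare n κ := by
  intro p hp
  by_contra hpκ
  have hmean := (stopsAt_of_mem_stoppingSquare hp).1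
  rw [dyadicMean_eq_zero_of_notMem hv (by lia) hpκ] at hmean
  exact hmean.not_gt hl

lemma summable_volume_stoppingSquare_and_tsum_le (hv : Integrable v) (hv0 : 0 ≤ v) (hl : 0 < l) :
    Summable (fun x => volume.real (stoppingSquare n v l x)) ∧
      ∑' x, volume.real (stoppingSquare n v l x) ≤ (∫ p, v p) / l := by
  have hsum := hasSum_integral_iUnion (s := stoppingSquare n v l)
    (fun _ => measurableSet_dyadicSquare _ _) pairwise_disjoint_stoppingSquare hv.integrableOn
  have hle (x : stoppingIndices n v l) :
      volume.real (stoppingSquare n v l x) ≤ (∫ p in stoppingSquare n v l x, v p) / l := by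
    have havg := (lt_setAverage_stoppingSquare x).le
    rw [le_div_iff₀ hl]
    rw [stoppingSquare] at havg ⊢
    rw [setIntegral_dyadicSquare, volume_real_dyadicSquare, smul_eq_mul]
    gcongr
  have hvol := Summable.of_nonneg_of_le (fun _ => measureReal_nonneg) hle
    (hsum.summable.div_const l)
  refine ⟨hvol, ?_⟩
  calc ∑' x, volume.real (stoppingSquare n v l x)
    _ ≤ ∑' x, (∫ p in stoppingSquare n v l x, v p) / l :=
      hvol.tsum_le_tsum hle (hsum.summable.div_const l)
    _ = (∫ p in ⋃ x, stoppingSquare n v l x, v p) / l := by rw [tsum_div_const, hsum.tsum_eq]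
    _ ≤ (∫ p, v p) / l :=
      div_le_div_of_nonneg_right (setIntegral_le_integral hv (.of_forall hv0)) hl.le

end stopping

section oscillation

variable {X E : Type*} [MeasurableSpace X] [NormedAddCommGroup E] [NormedSpace ℝ E]
  {μ : Measure X} {Q : Set X} {g : X → E}

/-- The oscillation of `g` on `Q`: the function equal to `g` minus its average over `Q` on `Q`, and
to `0` elsewhere. -/
def oscillation (μ : Measure X) (Q : Set X) (g : X → E) : X → E :=
  Q.indicator fun x => g x - ⨍ y in Q, g y ∂μ

lemma integrable_oscillation (hg : Integrable g μ) (hQ : MeasurableSet Q) (hμQ : μ Q ≠ ⊤) :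
    Integrable (oscillation μ Q g) μ :=
  (integrable_indicator_iff hQ).2 (hg.integrableOn.sub (integrableOn_const hμQ))

lemma integral_oscillation [CompleteSpace E] (hQ : MeasurableSet Q) (hμQ : μ Q ≠ ⊤) :
    ∫ x, oscillation μ Q g x ∂μ = 0 := by
  rw [oscillation, integral_indicator hQ, setAverage_sub_setAverage hμQ]

lemma BoundedOn.oscillation {g : ℝ × ℝ → E} {R : Set (ℝ × ℝ)} {M : ℝ} (hg : BoundedOn g R M)
    (n : ℤ) (κ : ℤ × ℤ) :
    BoundedOn (oscillation volume (dyadicSquare n κ) g) (dyadicSquare n κ) (M + M) where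
  ae_norm_le := by
    filter_upwards [hg.ae_norm_le] with x hx
    exact (norm_indicator_le_norm_self _ x).trans
      (norm_sub_le_of_le hx (norm_setAverage_dyadicSquare_le hg.ae_norm_le))
  ae_eq_zero := .of_forall fun _ hx => indicator_of_notMem hx _

end oscillation

lemma BoundedOn.integral_norm_le {X E : Type*} [MeasureSpace X] [NormedAddCommGroup E] {g : X → E}
    {Q : Set X} {M : ℝ} (hg : BoundedOn g Q M) (hQ : MeasurableSet Q) (hvol : volume Q ≠ ⊤) :
    ∫ x, ‖g x‖ ≤ M * volume.real Q := by
  calc ∫ x, ‖g x‖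
    _ ≤ ∫ x, Q.indicator (fun _ => M) x :=
      integral_mono_of_nonneg (.of_forall fun _ => norm_nonneg _)
        ((integrable_indicator_iff hQ).2 (integrableOn_const hvol)) hg.ae_norm_le_indicator
    _ = M * volume.real Q := by
      rw [integral_indicator_const _ hQ, smul_eq_mul, mul_comm]

section CalderonZygmund

lemma hasSum_oscillation_of_mem {ι X E : Type*} [MeasurableSpace X] [NormedAddCommGroup E]
    [NormedSpace ℝ E] {μ : Measure X} {Q : ι → Set X} (hQ : Pairwise (Disjoint on Q)) (g : X → E)
    {i : ι} {x : X} (hx : x ∈ Q i) :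
    HasSum (fun j => oscillation μ (Q j) g x) (g x - ⨍ y in Q i, g y ∂μ) := by
  rw [← indicator_of_mem hx fun x => g x - ⨍ y in Q i, g y ∂μ]
  exact hasSum_single i fun j hj =>
    indicator_of_notMem (fun hxj => Set.disjoint_left.1 (hQ hj) hxj hx) _

lemma exists_tsum_mem_atomicSums_oscillation {ι : Type*} [Countable ι]
    {g : Lp 𝕜 1 (volume : Measure (ℝ × ℝ))} {R : Set (ℝ × ℝ)} {M : ℝ} (hg : BoundedOn g R M)
    {m : ι → ℤ} {κ : ι → ℤ × ℤ} (hdisj : Pairwise (Disjoint on fun i => dyadicSquare (m i) (κ i)))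
    (hvol : Summable fun i => volume.real (dyadicSquare (m i) (κ i))) :
    ∃ b : Lp 𝕜 1 (volume : Measure (ℝ × ℝ)),
      ∑' i, (M + M) * volume.real (dyadicSquare (m i) (κ i)) ∈ atomicSums b ∧
      ∀ᵐ p, (∀ i, p ∈ dyadicSquare (m i) (κ i) →
          b p = g p - ⨍ q in dyadicSquare (m i) (κ i), g q) ∧
        ((∀ i, p ∉ dyadicSquare (m i) (κ i)) → b p = 0) := by
  have hmeas (i : ι) := measurableSet_dyadicSquare (m i) (κ i)
  have hfin (i : ι) := (volume_dyadicSquare_lt_top (m i) (κ i)).ne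
  have hosc (i : ι) := hg.oscillation (m i) (κ i)
  have hint (i : ι) := integrable_oscillation (L1.integrable_coeFn g) (hmeas i) (hfin i)
  let u (i : ι) : Lp 𝕜 1 (volume : Measure (ℝ × ℝ)) := (hint i).toL1
  have hu (i : ι) : u i =ᵐ[volume] oscillation volume (dyadicSquare (m i) (κ i)) g :=
    (hint i).coeFn_toL1
  have hbound (i : ι) := (hosc i).congr (hu i).symm
  have hsum : Summable fun i => (M + M) * volume.real (dyadicSquare (m i) (κ i)) :=
    hvol.mul_left (M + M)
  have hunorm : Summable fun i => ‖u i‖ := by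
    refine hsum.of_nonneg_of_le (fun i => norm_nonneg (u i)) fun i => ?_
    rw [L1.norm_eq_integral_norm]
    exact (hbound i).integral_norm_le (hmeas i) (hfin i)
  refine ⟨∑' i, u i, ?_, ?_⟩
  · simp only [volume_real_dyadicSquare] at hsum ⊢
    refine tsum_mem_atomicSums_of_boundedOn (fun i => by positivity)
      (fun i => (hbound i).mono (dyadicSquare_subset_square _ _)) (fun i => ?_) hsum
      hunorm.of_norm.hasSum
    rw [integral_congr_ae (hu i), integral_oscillation (hmeas i) (hfin i)]
  · filter_upwards [Lp.hasSum_coeFn_tsum (tsum_enorm_ne_top_iff_summable_norm.2 hunorm),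
      ae_all_iff.2 hu] with p hp hup
    simp only [hup] at hp
    refine ⟨fun i hi => hp.unique (hasSum_oscillation_of_mem hdisj g hi), fun h => ?_⟩
    simp only [oscillation, indicator_of_notMem (h _)] at hp
    exact hp.unique hasSum_zero

lemma norm_setAverage_dyadicSquare_le_setAverage_norm {E : Type*} [NormedAddCommGroup E]
    [NormedSpace ℝ E] (n : ℤ) (κ : ℤ × ℤ) (g : ℝ × ℝ → E) :
    ‖⨍ p in dyadicSquare n κ, g p‖ ≤ ⨍ p in dyadicSquare n κ, ‖g p‖ := by
  rw [setAverage_eq, setAverage_eq, norm_smul, smul_eq_mul,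
    Real.norm_of_nonneg (inv_nonneg.2 measureReal_nonneg)]
  gcongr
  exact norm_integral_le_integral_norm _

lemma dyadicMean_le_of_integral_le {v : ℝ × ℝ → ℝ} (hv : Integrable v) (hv0 : 0 ≤ v) {n : ℤ}
    {l : ℝ} (hl : ∫ p, v p ≤ l * ((2 : ℝ) ^ (-n)) ^ 2) (p : ℝ × ℝ) : dyadicMean n v p ≤ l := by
  have h := (setIntegral_le_integral (s := dyadicSquare n (dyadicIdx n p)) hv
    (.of_forall hv0)).trans hl
  rw [setIntegral_dyadicSquare, smul_eq_mul, mul_comm] at h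
  exact le_of_mul_le_mul_right h (by positivity)

lemma exists_calderonZygmund_decomposition {g : Lp 𝕜 1 (volume : Measure (ℝ × ℝ))} {n : ℤ}
    {κ : ℤ × ℤ} {M l : ℝ} (hg : BoundedOn g (dyadicSquare n κ) M) (hl : 0 < l)
    (hnorm : ‖g‖ ≤ l * ((2 : ℝ) ^ (-n)) ^ 2) :
    ∃ b : Lp 𝕜 1 (volume : Measure (ℝ × ℝ)), BoundedOn (g - b) (dyadicSquare n κ) (4 * l) ∧
      ∃ r ∈ atomicSums b, r ≤ 2 * M * (‖g‖ / l) := by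
  set v : ℝ × ℝ → ℝ := fun p => ‖g p‖
  have hv : Integrable v := (L1.integrable_coeFn g).norm
  have hv0 : 0 ≤ v := fun p => norm_nonneg (g p)
  have hvg : ∫ p, v p = ‖g‖ := (L1.norm_eq_integral_norm g).symm
  have hmean : ∀ p, dyadicMean n v p ≤ l := dyadicMean_le_of_integral_le hv hv0 (hvg ▸ hnorm)
  have hsub : ∀ x, stoppingSquare n v l x ⊆ dyadicSquare n κ :=
    stoppingSquare_subset (hg.ae_eq_zero.mono fun p hp hpκ => norm_eq_zero.2 (hp hpκ)) hl
  obtain ⟨hvol, htsum⟩ := summable_volume_stoppingSquare_and_tsum_le (n := n) hv hv0 hl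
  obtain ⟨b, hb, hbp⟩ := exists_tsum_mem_atomicSums_oscillation hg
    (pairwise_disjoint_stoppingSquare (n := n) (v := v) (l := l)) hvol
  refine ⟨b, ⟨?_, ?_⟩, _, hb, ?_⟩
  · filter_upwards [hbp, Lp.coeFn_sub g b, ae_tendsto_dyadicMean n hv.locallyIntegrable]
      with p ⟨hin, hout⟩ hsubp hlim
    rw [hsubp, Pi.sub_apply]
    by_cases hp : ∃ x, p ∈ stoppingSquare n v l x
    · obtain ⟨x, hx⟩ := hp
      rw [hin x hx, sub_sub_cancel]
      exact (norm_setAverage_dyadicSquare_le_setAverage_norm _ _ g).trans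
        (setAverage_stoppingSquare_le hv hv0 hmean x)
    · push Not at hp
      rw [hout hp, sub_zero]
      have : ‖g p‖ ≤ l := le_of_tendsto' hlim (dyadicMean_le_of_notMem_stoppingSquare hp)
      linarith
  · filter_upwards [hbp, Lp.coeFn_sub g b, hg.ae_eq_zero] with p ⟨_, hout⟩ hsubp hgp hp
    rw [hsubp, Pi.sub_apply, hgp hp, hout fun x hx => hp (hsub x hx), sub_zero]
  · rw [tsum_mul_left, ← two_mul, ← hvg]
    have := hg.nonneg
    gcongr
    exact htsum

lemma H1.norm_le_of_boundedOn_dyadicSquare {F : H1 𝕜} {n : ℤ} {κ : ℤ × ℤ} {M l : ℝ}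
    (hF : BoundedOn (toL1 F) (dyadicSquare n κ) M) (hl : 0 < l)
    (hnorm : ‖toL1 F‖ ≤ l * ((2 : ℝ) ^ (-n)) ^ 2) :
    ‖F‖ ≤ 4 * l * ((2 : ℝ) ^ (-n)) ^ 2 + 2 * M * (‖toL1 F‖ / l) := by
  obtain ⟨b, hgood, r, hr, hrle⟩ := exists_calderonZygmund_decomposition hF hl hnorm
  let B : H1 𝕜 := ⟨b, r, hr⟩
  have hFB : BoundedOn (toL1 (F - B)) (square (corner n κ) ((2 : ℝ) ^ (-n))) (4 * l) := by
    rw [map_sub]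
    exact hgood.mono (dyadicSquare_subset_square n κ)
  calc ‖F‖ ≤ ‖F - B‖ + ‖B‖ := by simpa using norm_add_le (F - B) B
    _ ≤ 4 * l * ((2 : ℝ) ^ (-n)) ^ 2 + 2 * M * (‖toL1 F‖ / l) := by
      gcongr
      · exact norm_le_of_mem (mem_atomicSums_of_boundedOn (by positivity) hFB (integral_toL1 _))
      · exact (norm_le_of_mem (f := B) hr).trans hrle

end CalderonZygmund

section haarPolynomials

/-- The functions equal almost everywhere to a finite linear combination of Haar functions. -/
def haarPolynomials (𝕜 : Type*) [RCLike 𝕜] : Submodule 𝕜 (ℝ × ℝ → 𝕜) where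
  carrier := {f | ∃ w ∈ Submodule.span 𝕜 (haarSystem 𝕜), H1.toL1 w =ᵐ[volume] f}
  zero_mem' := ⟨0, zero_mem _, by rw [map_zero]; exact Lp.coeFn_zero 𝕜 1 volume⟩
  add_mem' := by
    rintro f g ⟨v, hv, hvf⟩ ⟨w, hw, hwg⟩
    refine ⟨v + w, add_mem hv hw, ?_⟩
    rw [map_add]
    exact (Lp.coeFn_add _ _).trans (hvf.add hwg)
  smul_mem' := by
    rintro c f ⟨v, hv, hvf⟩
    refine ⟨c • v, Submodule.smul_mem _ c hv, ?_⟩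
    rw [map_smul]
    exact (Lp.coeFn_smul _ _).trans (hvf.const_smul c)

lemma mem_haarPolynomials_of_ae_eq {f g : ℝ × ℝ → 𝕜} (hf : f ∈ haarPolynomials 𝕜)
    (hfg : f =ᵐ[volume] g) : g ∈ haarPolynomials 𝕜 :=
  let ⟨w, hw, hwf⟩ := hf
  ⟨w, hw, hwf.trans hfg⟩

lemma haarFun_mem_haarPolynomials (j : Fin 3) (n k l : ℤ) :
    (fun p => (haarFun j n k l p : 𝕜)) ∈ haarPolynomials 𝕜 :=
  ⟨haar 𝕜 j n k l, Submodule.subset_span ⟨j, n, k, l, rfl⟩, (memLp_haarFun 𝕜 j n k l).coeFn_toLp⟩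

lemma chi_sub_intCast {t : ℝ} {k : ℤ} (h : t - k ≠ 1) :
    chi (t - k) = if ⌊t⌋ = k then 1 else 0 := by
  have hk : t - k ∈ Icc (0 : ℝ) 1 ↔ ⌊t⌋ = k := by
    rw [Int.floor_eq_iff, mem_Icc, sub_nonneg, h.le_iff_lt, sub_lt_iff_lt_add']
  simp only [chi, indicator_apply, hk, Pi.one_apply]

lemma ite_floor_two_mul_eq (m : ℤ) (t : ℝ) :
    (if ⌊2 * t⌋ = m then (1 : ℝ) else 0) =
      ((if ⌊t⌋ = m / 2 then 1 else 0) + (-1) ^ m * haarH (t - (m / 2 : ℤ))) / 2 := by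
  obtain ⟨k, rfl | rfl⟩ := m.even_or_odd'
  · rw [(even_two_mul k).neg_one_zpow, Int.mul_ediv_cancel_left k two_ne_zero]
    simp only [haarH, indicator_apply, mem_Ico, Int.floor_eq_iff, Pi.one_apply]
    push_cast
    grind
  · rw [(odd_two_mul_add_one k).neg_one_zpow, show (2 * k + 1) / 2 = k by lia]
    simp only [haarH, indicator_apply, mem_Ico, Int.floor_eq_iff, Pi.one_apply]
    push_cast
    grind

lemma indicator_dyadicSquare_one (n : ℤ) (κ : ℤ × ℤ) (p : ℝ × ℝ) :
    (dyadicSquare n κ).indicator (1 : ℝ × ℝ → ℝ) p =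
      (if ⌊(2 : ℝ) ^ n * p.1⌋ = κ.1 then 1 else 0) *
        (if ⌊(2 : ℝ) ^ n * p.2⌋ = κ.2 then 1 else 0) := by
  classical
  simp only [indicator_apply, mem_dyadicSquare, dyadicIdx, Prod.ext_iff, Pi.one_apply,
    ite_zero_mul_ite_zero, mul_one]

lemma ae_two_zpow_mul_sub_ne_one (n : ℤ) (κ : ℤ × ℤ) :
    ∀ᵐ p : ℝ × ℝ, (2 : ℝ) ^ n * p.1 - κ.1 ≠ 1 ∧ (2 : ℝ) ^ n * p.2 - κ.2 ≠ 1 := by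
  have key (k : ℤ) : ∀ᵐ x : ℝ, (2 : ℝ) ^ n * x - k ≠ 1 := by
    filter_upwards [Measure.ae_ne volume (((2 : ℝ) ^ n)⁻¹ * (k + 1))] with x hx h
    exact hx (by rw [← sub_eq_iff_eq_add'.1 h, inv_mul_cancel_left₀ (by positivity)])
  exact (Measure.quasiMeasurePreserving_fst.ae (key κ.1)).and
    (Measure.quasiMeasurePreserving_snd.ae (key κ.2))

lemma ae_indicator_dyadicSquare_succ (n : ℤ) (κ : ℤ × ℤ) :
    ∀ᵐ p : ℝ × ℝ, (dyadicSquare (n + 1) κ).indicator (1 : ℝ × ℝ → ℝ) p =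
      4⁻¹ * (dyadicSquare n (ancestor 1 κ)).indicator (1 : ℝ × ℝ → ℝ) p +
      (((2 : ℝ) ^ n)⁻¹ / 4 * (-1) ^ κ.1 * haarFun 0 n (ancestor 1 κ).1 (ancestor 1 κ).2 p +
       ((2 : ℝ) ^ n)⁻¹ / 4 * (-1) ^ κ.2 * haarFun 1 n (ancestor 1 κ).1 (ancestor 1 κ).2 p +
       ((2 : ℝ) ^ n)⁻¹ / 4 * ((-1) ^ κ.1 * (-1) ^ κ.2) *
        haarFun 2 n (ancestor 1 κ).1 (ancestor 1 κ).2 p) := by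
  filter_upwards [ae_two_zpow_mul_sub_ne_one n (ancestor 1 κ)] with p ⟨h₁, h₂⟩
  have hdouble (x : ℝ) : (2 : ℝ) ^ (n + 1) * x = 2 * ((2 : ℝ) ^ n * x) := by
    rw [zpow_add_one₀ two_ne_zero]; ring
  simp only [indicator_dyadicSquare_one, hdouble, ite_floor_two_mul_eq, haarFun, Psi,
    Matrix.cons_val_zero, Matrix.cons_val_one, Matrix.cons_val, chi_sub_intCast h₁,
    chi_sub_intCast h₂]
  simp only [ancestor, pow_one]
  field_simp
  ring

lemma indicator_dyadicSquare_succ_sub_mem (n : ℤ) (κ : ℤ × ℤ) :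
    (dyadicSquare (n + 1) κ).indicator 1 -
      (4 : 𝕜)⁻¹ • (dyadicSquare n (ancestor 1 κ)).indicator 1 ∈ haarPolynomials 𝕜 := by
  have hcast (m : ℤ) (η : ℤ × ℤ) (p : ℝ × ℝ) : (dyadicSquare m η).indicator (1 : ℝ × ℝ → 𝕜) p =
      (((dyadicSquare m η).indicator (1 : ℝ × ℝ → ℝ) p : ℝ) : 𝕜) := by
    by_cases hp : p ∈ dyadicSquare m η <;> simp [hp]
  have hmem (j : Fin 3) (c : ℝ) := Submodule.smul_mem _ (c : 𝕜)
    (haarFun_mem_haarPolynomials (𝕜 := 𝕜) j n (ancestor 1 κ).1 (ancestor 1 κ).2)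
  refine mem_haarPolynomials_of_ae_eq (add_mem (add_mem
    (hmem 0 (((2 : ℝ) ^ n)⁻¹ / 4 * (-1) ^ κ.1)) (hmem 1 (((2 : ℝ) ^ n)⁻¹ / 4 * (-1) ^ κ.2)))
    (hmem 2 (((2 : ℝ) ^ n)⁻¹ / 4 * ((-1) ^ κ.1 * (-1) ^ κ.2)))) ?_
  filter_upwards [ae_indicator_dyadicSquare_succ n κ] with p hp
  simp only [Pi.sub_apply, Pi.add_apply, Pi.smul_apply, smul_eq_mul, hcast, hp]
  push_cast
  ring

lemma indicator_dyadicSquare_sub_mem (n : ℤ) (i : ℕ) (κ : ℤ × ℤ) :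
    (dyadicSquare (n + i) κ).indicator 1 -
      (4 : 𝕜)⁻¹ ^ i • (dyadicSquare n (ancestor i κ)).indicator 1 ∈ haarPolynomials 𝕜 := by
  induction i generalizing κ with
  | zero => simp [ancestor_zero]
  | succ i ih =>
    have h := add_mem (indicator_dyadicSquare_succ_sub_mem (𝕜 := 𝕜) (n + i) κ)
      (Submodule.smul_mem _ (4 : 𝕜)⁻¹ (ih (ancestor 1 κ)))
    rwa [smul_sub, smul_smul, ← pow_succ', sub_add_sub_cancel, ancestor_ancestor, add_assoc,
      ← Nat.cast_succ] at h

lemma dyadicMean_eq_sum_descendants {f : ℝ × ℝ → 𝕜} {n : ℤ} {κ : ℤ × ℤ}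
    (hf : ∀ᵐ p, p ∉ dyadicSquare n κ → f p = 0) (i : ℕ) :
    dyadicMean (n + i) f = ∑ κ' ∈ descendants i κ,
      (⨍ q in dyadicSquare (n + i) κ', f q) • (dyadicSquare (n + i) κ').indicator 1 := by
  classical
  ext p
  simp only [Finset.sum_apply, Pi.smul_apply, smul_eq_mul, indicator_apply, mem_dyadicSquare,
    Pi.one_apply, mul_ite, mul_one, mul_zero, Finset.sum_ite_eq, mem_descendants,
    ancestor_dyadicIdx]
  split_ifs with hp
  · rfl
  · exact dyadicMean_eq_zero_of_notMem hf (by lia) hp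

lemma sum_descendants_setAverage {E : Type*} [NormedAddCommGroup E] [NormedSpace ℝ E]
    {f : ℝ × ℝ → E} (hf : Integrable f) (n : ℤ) (i : ℕ) (κ : ℤ × ℤ) :
    ∑ κ' ∈ descendants i κ, ⨍ q in dyadicSquare (n + i) κ', f q =
      (((2 : ℝ) ^ (-(n + i))) ^ 2)⁻¹ • ∫ q in dyadicSquare n κ, f q := by
  rw [← biUnion_descendants n i κ, integral_biUnion_finset _
    (fun κ' _ => measurableSet_dyadicSquare (n + i) κ')
    ((pairwise_disjoint_dyadicSquare (n + i)).set_pairwise _) fun _ _ => hf.integrableOn]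
  simp only [setIntegral_dyadicSquare, ← Finset.smul_sum]
  rw [inv_smul_smul₀ (by positivity)]

lemma dyadicMean_mem_haarPolynomials {f : ℝ × ℝ → 𝕜} (hf : Integrable f) {n : ℤ} {κ : ℤ × ℤ}
    (hsupp : ∀ᵐ p, p ∉ dyadicSquare n κ → f p = 0) (hint : ∫ p, f p = 0) (i : ℕ) :
    dyadicMean (n + i) f ∈ haarPolynomials 𝕜 := by
  set a : ℤ × ℤ → 𝕜 := fun κ' => ⨍ q in dyadicSquare (n + i) κ', f q
  have hsum : ∑ κ' ∈ descendants i κ, a κ' = 0 := by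
    rw [sum_descendants_setAverage hf, setIntegral_eq_integral_of_ae_compl_eq_zero hsupp, hint,
      smul_zero]
  have hdiff : ∑ κ' ∈ descendants i κ, a κ' • ((dyadicSquare (n + i) κ').indicator 1 -
      (4 : 𝕜)⁻¹ ^ i • (dyadicSquare n (ancestor i κ')).indicator 1) ∈ haarPolynomials 𝕜 :=
    Submodule.sum_mem _ fun κ' _ => Submodule.smul_mem _ _ (indicator_dyadicSquare_sub_mem n i κ')
  have hparent : ∑ κ' ∈ descendants i κ,
      a κ' • (4 : 𝕜)⁻¹ ^ i • (dyadicSquare n (ancestor i κ')).indicator (1 : ℝ × ℝ → 𝕜) = 0 := by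
    rw [Finset.sum_congr rfl fun κ' hκ' => by rw [mem_descendants.1 hκ'], ← Finset.sum_smul, hsum,
      zero_smul]
  rw [dyadicMean_eq_sum_descendants hsupp]
  simpa only [smul_sub, Finset.sum_sub_distrib, hparent, sub_zero] using hdiff

end haarPolynomials

section HaarClosure

namespace H1

lemma exists_mem_span_haarSystem_norm_sub_le {F : H1 𝕜} {n : ℤ} {κ : ℤ × ℤ} {M : ℝ}
    (hF : BoundedOn (toL1 F) (dyadicSquare n κ) M) {l : ℝ} (hl : 0 < l) :
    ∃ w ∈ Submodule.span 𝕜 (haarSystem 𝕜), ‖F - w‖ ≤ 4 * l * ((2 : ℝ) ^ (-n)) ^ 2 + l := by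
  choose w hw hwF using
    dyadicMean_mem_haarPolynomials (L1.integrable_coeFn _) hF.ae_eq_zero (integral_toL1 F)
  have hsub (i : ℕ) : toL1 (F - w i) =ᵐ[volume] toL1 F - dyadicMean (n + i) (toL1 F) := by
    rw [map_sub]
    exact (Lp.coeFn_sub _ _).trans (.sub .rfl (hwF i))
  have hbound (i : ℕ) : BoundedOn (toL1 (F - w i)) (dyadicSquare n κ) (M + M) :=
    (hF.sub (hF.dyadicMean (by lia))).congr (hsub i).symm
  have hlim : Tendsto (fun i => ‖toL1 (F - w i)‖) atTop (𝓝 0) := by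
    refine (tendsto_integral_norm_sub_dyadicMean (L1.integrable_coeFn _) hF).congr fun i => ?_
    rw [L1.norm_eq_integral_norm]
    exact integral_congr_ae ((hsub i).fun_comp norm).symm
  have hlim' : Tendsto (fun i => 2 * (M + M) * (‖toL1 (F - w i)‖ / l)) atTop (𝓝 0) := by
    simpa only [zero_div, mul_zero] using (hlim.div_const l).const_mul (2 * (M + M))
  obtain ⟨i, hi, hi'⟩ := ((hlim.eventually_le_const
    (show 0 < l * ((2 : ℝ) ^ (-n)) ^ 2 by positivity)).and
    (hlim'.eventually_le_const hl)).exists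
  exact ⟨w i, hw i, (norm_le_of_boundedOn_dyadicSquare (hbound i) hl hi).trans (by gcongr)⟩

lemma mem_closure_span_haarSystem_of_boundedOn {F : H1 𝕜} {n : ℤ} {κ : ℤ × ℤ} {M : ℝ}
    (hF : BoundedOn (toL1 F) (dyadicSquare n κ) M) :
    F ∈ (Submodule.span 𝕜 (haarSystem 𝕜)).topologicalClosure := by
  refine Metric.mem_closure_iff.2 fun ε hε => ?_
  set s := (2 : ℝ) ^ (-n)
  obtain ⟨w, hw, hle⟩ :=
    exists_mem_span_haarSystem_norm_sub_le hF (l := ε / (2 * (4 * s ^ 2 + 1))) (by positivity)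
  refine ⟨w, hw, ?_⟩
  calc dist F w ≤ 4 * (ε / (2 * (4 * s ^ 2 + 1))) * s ^ 2 + ε / (2 * (4 * s ^ 2 + 1)) := by
        rwa [dist_eq_norm]
    _ = ε / 2 := by field_simp
    _ < ε := half_lt_self hε

end H1

end HaarClosure

section Quadrants

/-- The indices of the dyadic squares contained, up to null sets, in each quadrant. -/
def indexQuadrant : Fin 4 → Set (ℤ × ℤ) :=
  ![Ici 0 ×ˢ Ici 0, Iio 0 ×ˢ Ici 0, Iio 0 ×ˢ Iio 0, Ici 0 ×ˢ Iio 0]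

lemma measurableSet_quadrant (i : Fin 4) : MeasurableSet (quadrant i) := by
  fin_cases i <;> exact .prod (by measurability) (by measurability)

lemma ae_coord_ne_zero : ∀ᵐ p : ℝ × ℝ, p.1 ≠ 0 ∧ p.2 ≠ 0 :=
  (Measure.quasiMeasurePreserving_fst.ae (Measure.ae_ne volume 0)).and
    (Measure.quasiMeasurePreserving_snd.ae (Measure.ae_ne volume 0))

lemma ae_mem_quadrant_iff (n : ℤ) (i : Fin 4) :
    ∀ᵐ p, p ∈ quadrant i ↔ dyadicIdx n p ∈ indexQuadrant i := by
  filter_upwards [ae_coord_ne_zero] with p ⟨h₁, h₂⟩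
  have hfloor (x : ℝ) : 0 ≤ ⌊(2 : ℝ) ^ n * x⌋ ↔ 0 ≤ x := by
    rw [Int.floor_nonneg, mul_nonneg_iff_of_pos_left (by positivity)]
  fin_cases i <;>
    simp [quadrant, indexQuadrant, dyadicIdx, ← not_le, hfloor, h₁.symm.le_iff_lt,
      h₂.symm.le_iff_lt]

lemma setIntegral_quadrant_eq_zero {E : Type*} [NormedAddCommGroup E] [NormedSpace ℝ E]
    {f : ℝ × ℝ → E} {n : ℤ} {κ : ℤ × ℤ} (hf : ∀ᵐ p, p ∉ dyadicSquare n κ → f p = 0)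
    (hint : ∫ p, f p = 0) (i : Fin 4) : ∫ p in quadrant i, f p = 0 := by
  by_cases hκ : κ ∈ indexQuadrant i
  · rw [setIntegral_eq_integral_of_ae_compl_eq_zero, hint]
    filter_upwards [hf, ae_mem_quadrant_iff n i] with p hp hpi hpq
    exact hp fun hpκ => hpq (hpi.2 (hpκ ▸ hκ))
  · refine setIntegral_eq_zero_of_ae_eq_zero ?_
    filter_upwards [hf, ae_mem_quadrant_iff n i] with p hp hpi hpq
    exact hp fun hpκ => hκ (hpκ ▸ hpi.1 hpq)

lemma ae_sum_indicator_quadrant {E : Type*} [AddCommMonoid E] (f : ℝ × ℝ → E) :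
    ∀ᵐ p, ∑ i, (quadrant i).indicator f p = f p := by
  filter_upwards [ae_coord_ne_zero] with p ⟨h₁, h₂⟩
  rcases h₁.lt_or_gt with h₁ | h₁ <;> rcases h₂.lt_or_gt with h₂ | h₂ <;>
    simp [Fin.sum_univ_four, quadrant, h₁, h₂, h₁.not_gt, h₂.not_gt]

lemma exists_quadrant_inter_ball_subset_dyadicSquare (n : ℤ) (i : Fin 4) :
    ∃ κ, quadrant i ∩ Metric.ball 0 ((2 : ℝ) ^ (-n)) ⊆ dyadicSquare n κ := by
  have hpos (x : ℝ) (hx : 0 < x) (hxn : |x| < (2 : ℝ) ^ (-n)) : ⌊(2 : ℝ) ^ n * x⌋ = 0 := by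
    rw [floor_two_zpow_mul_eq_iff, Int.cast_zero, zero_mul, zero_add]
    exact ⟨hx.le, (le_abs_self x).trans_lt hxn⟩
  have hneg (x : ℝ) (hx : x < 0) (hxn : |x| < (2 : ℝ) ^ (-n)) : ⌊(2 : ℝ) ^ n * x⌋ = -1 := by
    rw [floor_two_zpow_mul_eq_iff, Int.cast_neg, Int.cast_one, neg_one_mul, neg_add_cancel]
    exact ⟨(abs_lt.1 hxn).1.le, hx⟩
  refine ⟨(![(0, 0), (-1, 0), (-1, -1), (0, -1)] : Fin 4 → ℤ × ℤ) i, fun p ⟨hp, hpn⟩ => ?_⟩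
  rw [mem_ball_zero_iff, Prod.norm_def, max_lt_iff] at hpn
  obtain ⟨h₁, h₂⟩ := hpn
  fin_cases i
  · exact Prod.ext (hpos _ hp.1 h₁) (hpos _ hp.2 h₂)
  · exact Prod.ext (hneg _ hp.1 h₁) (hpos _ hp.2 h₂)
  · exact Prod.ext (hneg _ hp.1 h₁) (hneg _ hp.2 h₂)
  · exact Prod.ext (hpos _ hp.1 h₁) (hneg _ hp.2 h₂)

lemma haar_mem_HA (j : Fin 3) (n k l : ℤ) : haar 𝕜 j n k l ∈ HA 𝕜 := by
  have hae : H1.toL1 (haar 𝕜 j n k l) =ᵐ[volume] fun p => (haarFun j n k l p : 𝕜) :=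
    (memLp_haarFun 𝕜 j n k l).coeFn_toLp
  refine setIntegral_quadrant_eq_zero (n := n) (κ := (k, l)) ?_ (H1.integral_toL1 _)
  filter_upwards [hae, (dyadicSquare_ae_eq_square n (k, l)).mem_iff] with p hp hmem hpκ
  rw [hp, haarFun_eq_zero j n k l (hmem.not.1 hpκ), RCLike.ofReal_zero]

end Quadrants

lemma ker_le_topologicalClosure_inf_ker {𝕂 X Y : Type*} [NontriviallyNormedField 𝕂]
    [CompleteSpace 𝕂] [NormedAddCommGroup X] [NormedSpace 𝕂 X] [NormedAddCommGroup Y]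
    [NormedSpace 𝕂 Y] [FiniteDimensional 𝕂 Y] (T : X →L[𝕂] Y) {D : Submodule 𝕂 X}
    (hD : Dense (D : Set X)) :
    T.ker ≤ (D ⊓ T.ker).topologicalClosure := by
  -- `T '' D` is closed, being finite-dimensional, so `T` maps `D` onto its range.
  have hrange : T.range ≤ D.map T.toLinearMap := by
    have hclosed : IsClosed (T '' D) := (D.map T.toLinearMap).closed_of_finiteDimensional
    rintro _ ⟨x, rfl⟩
    have h : T x ∈ closure (T '' D) := image_closure_subset_closure_image T.continuous
      (mem_image_of_mem T (hD x))
    rwa [hclosed.closure_eq] at h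
  let S : D →ₗ[𝕂] T.range := (T.toLinearMap.rangeRestrict).comp D.subtype
  have hS : S.range = ⊤ := LinearMap.range_eq_top.2 fun ⟨y, hy⟩ =>
    let ⟨d, hd, hdy⟩ := hrange hy
    ⟨⟨d, hd⟩, Subtype.ext hdy⟩
  obtain ⟨g, hg⟩ := S.exists_rightInverse_of_surjective hS
  let P : X → X := fun x => x - g (T.toLinearMap.rangeRestrict x)
  have hP : Continuous P := continuous_id.sub <| continuous_subtype_val.comp <|
    g.continuous_of_finiteDimensional.comp (T.continuous.subtype_mk _)
  have hPD : MapsTo P D (D ⊓ T.ker : Submodule 𝕂 X) := fun d hd => by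
    refine ⟨D.sub_mem hd (g _).2, ?_⟩
    have h : T (g (T.toLinearMap.rangeRestrict d)) = T d :=
      congrArg Subtype.val (LinearMap.congr_fun hg (T.toLinearMap.rangeRestrict d))
    exact (map_sub T _ _).trans (sub_eq_zero.2 h.symm)
  intro x hx
  have hPx : P x = x := by
    have h : T.toLinearMap.rangeRestrict x = 0 := Subtype.ext hx
    simp only [P, h, map_zero, ZeroMemClass.coe_zero, sub_zero]
  rw [← hPx]
  exact map_mem_closure hP (hD x) hPD

namespace H1

/-- The inclusion of `H¹(ℝ²)` into `L¹(ℝ²)` as a continuous linear map. -/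
def toL1CLM (𝕜 : Type*) [RCLike 𝕜] : H1 𝕜 →L[𝕜] Lp 𝕜 1 (volume : Measure (ℝ × ℝ)) :=
  toL1.mkContinuous 1 fun F => by rw [one_mul]; exact norm_toL1_le F

/-- The integrals over the four quadrants, as a continuous linear map with kernel `H^A(ℝ²)`. -/
def quadrantIntegrals (𝕜 : Type*) [RCLike 𝕜] : H1 𝕜 →L[𝕜] Fin 4 → 𝕜 :=
  ContinuousLinearMap.pi fun i => (setIntegralCLM 𝕜 volume (quadrant i)).comp (toL1CLM 𝕜)

lemma ker_quadrantIntegrals : (quadrantIntegrals 𝕜).ker = HA 𝕜 := by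
  ext F
  exact funext_iff

/-- The bounded functions of bounded support in `H¹(ℝ²)`. -/
def boundedlySupported (𝕜 : Type*) [RCLike 𝕜] : Submodule 𝕜 (H1 𝕜) where
  carrier := {F | ∃ Q M, Bornology.IsBounded Q ∧ BoundedOn (toL1 F) Q M}
  zero_mem' := by
    refine ⟨∅, 0, Bornology.isBounded_empty, ?_⟩
    rw [map_zero]
    exact BoundedOn.congr ⟨by simp, by simp⟩ (Lp.coeFn_zero 𝕜 1 volume).symm
  add_mem' := by
    rintro F G ⟨Q, M, hQ, hF⟩ ⟨R, N, hR, hG⟩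
    refine ⟨Q ∪ R, M + N, hQ.union hR, ?_⟩
    rw [map_add]
    exact (hF.add hG).congr (Lp.coeFn_add _ _).symm
  smul_mem' := by
    rintro c F ⟨Q, M, hQ, hF⟩
    refine ⟨Q, ‖c‖ * M, hQ, ?_⟩
    rw [map_smul]
    exact (hF.smul c).congr (Lp.coeFn_smul _ _).symm

lemma tendsto_sum_range_smul {F : H1 𝕜} {coeff : ℕ → 𝕜} {A : ℕ → H1 𝕜}
    (h : IsAtomicDecomposition coeff (fun j => toL1 (A j)) (toL1 F)) :
    Tendsto (fun N => ∑ j ∈ Finset.range N, coeff j • A j) atTop (𝓝 F) := by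
  obtain ⟨hA, hcoeff, hF⟩ := h
  refine tendsto_iff_norm_sub_tendsto_zero.2 <| squeeze_zero (fun _ => norm_nonneg _)
    (fun N => ?_) (tendsto_sum_nat_add fun j => ‖coeff j‖)
  rw [norm_sub_rev]
  refine norm_le_of_mem ⟨fun j => coeff (j + N), fun j => toL1 (A (j + N)),
    ⟨fun j => hA _, (summable_nat_add_iff N).2 hcoeff, ?_⟩, rfl⟩
  simpa only [map_sub, map_sum, map_smul] using (hasSum_nat_add_iff' N).2 hF

lemma exists_mem_boundedlySupported_toL1_eq {a : Lp 𝕜 1 (volume : Measure (ℝ × ℝ))}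
    (ha : IsAtom a) : ∃ A ∈ boundedlySupported 𝕜, toL1 A = a := by
  have hint := ha.integral_eq_zero
  obtain ⟨c, s, hs, h0, hle, -⟩ := ha
  have hbound : BoundedOn a (square c s) (1 / s ^ 2) := ⟨hle, h0⟩
  obtain ⟨A, rfl⟩ := exists_toL1_eq hs hbound hint
  exact ⟨A, ⟨_, _, (Metric.isBounded_Icc _ _).prod (Metric.isBounded_Icc _ _), hbound⟩, rfl⟩

lemma dense_boundedlySupported : Dense (boundedlySupported 𝕜 : Set (H1 𝕜)) := by
  intro F
  obtain ⟨-, coeff, a, hF, -⟩ := nonempty_atomicSums F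
  choose A hA hAa using fun j => exists_mem_boundedlySupported_toL1_eq (hF.1 j)
  refine mem_closure_of_tendsto (tendsto_sum_range_smul (coeff := coeff) (A := A) ?_)
    (.of_forall fun N => Submodule.sum_mem _ fun j _ => Submodule.smul_mem _ _ (hA j))
  simpa only [hAa]

lemma exists_mem_closure_span_haarSystem_ae_eq_indicator_quadrant {F : H1 𝕜}
    (hF : F ∈ boundedlySupported 𝕜 ⊓ HA 𝕜) (i : Fin 4) :
    ∃ G ∈ (Submodule.span 𝕜 (haarSystem 𝕜)).topologicalClosure,
      toL1 G =ᵐ[volume] (quadrant i).indicator (toL1 F) := by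
  obtain ⟨⟨Q, M, hQ, hbound⟩, hFA⟩ := hF
  obtain ⟨n, hn⟩ : ∃ n : ℤ, Q ⊆ Metric.ball 0 ((2 : ℝ) ^ (-n)) := by
    obtain ⟨r, hr⟩ := hQ.subset_ball 0
    obtain ⟨N, hN⟩ := pow_unbounded_of_one_lt r (one_lt_two (α := ℝ))
    refine ⟨-N, hr.trans (Metric.ball_subset_ball ?_)⟩
    rw [neg_neg, zpow_natCast]
    exact hN.le
  obtain ⟨κ, hκ⟩ := exists_quadrant_inter_ball_subset_dyadicSquare n i
  have hint := (L1.integrable_coeFn (toL1 F)).indicator (measurableSet_quadrant i)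
  have hg : BoundedOn (hint.toL1 _) (dyadicSquare n κ) M :=
    (hbound.indicator.mono ((inter_subset_inter_right _ hn).trans hκ)).congr
      hint.coeFn_toL1.symm
  have hg0 : ∫ p, hint.toL1 _ p = 0 := by
    rw [integral_congr_ae hint.coeFn_toL1, integral_indicator (measurableSet_quadrant i)]
    exact hFA i
  obtain ⟨G, hG⟩ := exists_toL1_eq (by positivity)
    (hg.mono (dyadicSquare_subset_square n κ)) hg0
  exact ⟨G, mem_closure_span_haarSystem_of_boundedOn (hG ▸ hg), hG ▸ hint.coeFn_toL1⟩

lemma boundedlySupported_inf_HA_le_closure_span_haarSystem :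
    boundedlySupported 𝕜 ⊓ HA 𝕜 ≤ (Submodule.span 𝕜 (haarSystem 𝕜)).topologicalClosure := by
  intro F hF
  choose G hG hGF using
    exists_mem_closure_span_haarSystem_ae_eq_indicator_quadrant hF
  have hsum : F = ∑ i, G i := by
    refine toL1_injective (Lp.ext ?_)
    rw [map_sum]
    filter_upwards [Lp.coeFn_finsetSum Finset.univ fun i => toL1 (G i), ae_all_iff.2 hGF,
      ae_sum_indicator_quadrant (toL1 F)] with p hp hGp hFp
    simp only [hp, Finset.sum_apply, hGp, hFp]
  rw [hsum]
  exact Submodule.sum_mem _ fun i _ => hG i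

end H1

lemma closure_span_haarSystem_le_HA :
    (Submodule.span 𝕜 (haarSystem 𝕜)).topologicalClosure ≤ HA 𝕜 := by
  rw [← H1.ker_quadrantIntegrals]
  refine Submodule.topologicalClosure_minimal _ (Submodule.span_le.2 ?_)
    (H1.quadrantIntegrals 𝕜).isClosed_ker
  rw [H1.ker_quadrantIntegrals]
  rintro _ ⟨j, n, k, l, rfl⟩
  exact haar_mem_HA j n k l

end HardyHaar

end

theorem theorem4p1 (𝕜 : Type*) [RCLike 𝕜] :
    (Submodule.span 𝕜 (HardyHaar.haarSystem 𝕜)).topologicalClosure = HardyHaar.HA 𝕜 := by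
  refine le_antisymm HardyHaar.closure_span_haarSystem_le_HA ?_
  calc HardyHaar.HA 𝕜
    _ = (HardyHaar.H1.quadrantIntegrals 𝕜).ker := HardyHaar.H1.ker_quadrantIntegrals.symm
    _ ≤ (HardyHaar.H1.boundedlySupported 𝕜 ⊓
          (HardyHaar.H1.quadrantIntegrals 𝕜).ker).topologicalClosure :=
      HardyHaar.ker_le_topologicalClosure_inf_ker _ HardyHaar.H1.dense_boundedlySupported
    _ = (HardyHaar.H1.boundedlySupported 𝕜 ⊓ HardyHaar.HA 𝕜).topologicalClosure := by
      rw [HardyHaar.H1.ker_quadrantIntegrals]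
    _ ≤ (Submodule.span 𝕜 (HardyHaar.haarSystem 𝕜)).topologicalClosure :=
      Submodule.topologicalClosure_minimal _
        HardyHaar.H1.boundedlySupported_inf_HA_le_closure_span_haarSystem
        (Submodule.isClosed_topologicalClosure _)
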